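/- Conventions. For a metric space $X$, $\mathrm{Lip}(X)$ denotes the real Lipschitz functions on $X$, $\mathrm{Lip}(\pi)$ the best Lipschitz constant, and $\mathrm{Lip}_b(X)\subset\mathrm{Lip}(X)$ the bounded ones. $\mathbf M_1(X)$ is the set of metric $1$-currents: bilinear maps $T:\mathrm{Lip}_b(X)\times \mathrm{Lip}(X)\to\mathbb R$ such that (i) there is a finite Borel measure $\mu$ on $X$ with $|T(f,\pi)|\le \mathrm{Lip}(\pi)\int_X|f|\,d\mu$ for all $(f,\pi)$; (ii) $T(f,\pi_j)\to T(f,\pi)$ whenever $\pi_j\to\pi$ pointwise with $\sup_j \mathrm{Lip}(\pi_j)<\infty$; (iii) $T(f,\pi)=0$ whenever $\pi$ is constant on a neighbourhood of the support of $f$. The least measure in (i) is $\|T\|$, and $\mathbf M(T)=\|T\|(X)$. The boundary is $\partial T(f)=T(1,f)$; $T$ is a cycle if $\partial T=0$; $\mathbf N_1(X)$ is the set of $T\in\mathbf M_1(X)$ whose boundary satisfies $|\partial T(f)|\le\int_X |f|\,d\nu$ for all $f\in \mathrm{Lip}_b(X)$ and some finite Borel measure $\nu$; and $\|\partial T\|_{\mathrm{KR}}=\sup\{T(1,f):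 f\in\mathrm{Lip}(X),\ \mathrm{Lip}(f)\le 1\}$. A Lipschitz curve $\theta:[0,1]\to X$ has length $\ell(\theta)=\int_0^1\limsup_{h\to0+}\frac{d(\theta(t+h),\theta(t))}{h}\,dt$ and defines the current $[\![\theta]\!](f,\pi)=\int_0^1 f(\theta(t))\,(\pi\circ\theta)'(t)\,dt$. It is a geodesic if $\ell(\theta)=d(\theta(0),\theta(1))$, and $X$ is a geodesic space if any two points are the end points of a geodesic. In a normed space, a polyhedral current is a finite real linear combination of the currents $[\![x,y]\!]$ of oriented segments. The space $X$ is piecewise quasiconvex with constant $c\ge1$ if for all $x,y\in X$ and $\varepsilon>0$ there are $m\ge 1$ and Lipschitz curves $\theta_1,\dots,\theta_m:[0,1]\to X$ such that, with $x_i=\theta_i(0)$ and $y_i=\theta_i(1)$, $$d(x,x_1)+d(y_m,y)+\sum_{i=1}^{m-1}d(x_{i+1},y_i)<\varepsilon\qquad\text{and}\qquad \sum_{i=1}^m\ell(\theta_i)\le c\,d(x,y).$$ Theorem. Let $X$ be a separable metric space which is piecewise quasiconvex with constant $c\ge1$, and let $T\in\mathbf M_1(X)$. For every $\varepsilon>0$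 there exist a cycle $C\in\mathbf M_1(X)$ and a sequence $(P_j)\subset\mathbf N_1(X)$, where each $P_j$ is a finite sum $$P_j=\sum_{i=1}^{r}\eta_i[\![\theta_i]\!],\qquad \eta_i\in\mathbb R,\quad \theta_i:[0,1]\to X\ \text{$1$-Lipschitz}\qquad(r,\eta_i,\theta_i\text{ depending on }j),$$ such that $$\mathbf M(T-C-P_j)\longrightarrow0\quad(j\to\infty)\qquad\text{and}\qquad \mathbf M(P_j)\le c\,\|\partial T\|_{\mathrm{KR}}+\varepsilon\quad\text{for all }j.$$ Moreover, (a) if $X$ is a geodesic space, then $C$ and the $P_j$ can be chosen so that in addition all the curves $\theta_i$ are geodesics; (b) if $X$ is a Banach space, then $C$ and the $P_j$ can be chosen so that in addition all the $P_j$ are polyhedral. -/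

import Mathlib

open MeasureTheory Filter Topology Set
open scoped ENNReal NNReal unitInterval

noncomputable section

namespace MetricCurrents

variable {X : Type*} [MetricSpace X]

/-! ### Lipschitz functions and metric forms -/

/-- `Lip(X)`: the space of real-valued Lipschitz functions on `X`. -/
def LipFun (X : Type*) [MetricSpace X] : Submodule ℝ (X → ℝ) where
  carrier := {f | ∃ K : ℝ≥0, LipschitzWith K f}
  add_mem' := by
    rintro f g ⟨K, hf⟩ ⟨L, hg⟩
    exact ⟨K + L, hf.add hg⟩
  zero_mem' := ⟨0, LipschitzWith.const 0⟩
  smul_mem' := by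
    rintro a f ⟨K, hf⟩
    refine ⟨‖a‖₊ * K, ?_⟩
    exact (lipschitzWith_smul a).comp hf

/-- `Lip_b(X)`: the space of bounded real-valued Lipschitz functions on `X`. -/
def LipBdd (X : Type*) [MetricSpace X] : Submodule ℝ (X → ℝ) where
  carrier := {f | (∃ K : ℝ≥0, LipschitzWith K f) ∧ ∃ M : ℝ, ∀ x, |f x| ≤ M}
  add_mem' := by
    rintro f g ⟨hf, M, hM⟩ ⟨hg, N, hN⟩
    refine ⟨(LipFun X).add_mem hf hg, M + N, fun x => ?_⟩
    exact (abs_add_le (f x) (g x)).trans (add_le_add (hM x) (hN x))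
  zero_mem' := ⟨(LipFun X).zero_mem, 0, fun x => by simp⟩
  smul_mem' := by
    rintro a f ⟨hf, M, hM⟩
    refine ⟨(LipFun X).smul_mem a hf, |a| * M, fun x => ?_⟩
    simpa [abs_mul] using mul_le_mul_of_nonneg_left (hM x) (abs_nonneg a)

theorem lipBdd_le_lipFun : LipBdd X ≤ LipFun X := fun _ hf => hf.1

/-- A bounded Lipschitz function, regarded as a Lipschitz function. -/
def LipBdd.toLipFun : LipBdd X →ₗ[ℝ] LipFun X := Submodule.inclusion lipBdd_le_lipFun

/-- The constant function `1`. -/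
def oneBdd (X : Type*) [MetricSpace X] : LipBdd X :=
  ⟨fun _ => 1, ⟨0, LipschitzWith.const 1⟩, 1, fun _ => by simp⟩

/-- Linear functionals on `D⁰(X) = Lip_b(X)`. -/
abbrev Functional0 (X : Type*) [MetricSpace X] := LipBdd X →ₗ[ℝ] ℝ

/-- Bilinear functionals on `D¹(X) = Lip_b(X) × Lip(X)`. -/
abbrev Functional1 (X : Type*) [MetricSpace X] := LipBdd X →ₗ[ℝ] LipFun X →ₗ[ℝ] ℝ

/-! ### Metric currents, mass, boundary -/

section Currents

variable [MeasurableSpace X]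

/-- `μ` is a finite Borel measure with `|T(f, π)| ≤ Lip(π) ∫ |f| dμ` for all `(f, π)`. Since
`Lip(π)` is the smallest Lipschitz constant of `π`, the inequality is asked for all constants. -/
def MassBound (T : Functional1 X) (μ : Measure X) : Prop :=
  IsFiniteMeasure μ ∧ ∀ (f : LipBdd X) (π : LipFun X) (K : ℝ≥0), LipschitzWith K (π : X → ℝ) →
    |T f π| ≤ K * ∫ x, |(f : X → ℝ) x| ∂μ

/-- A metric `1`-current: a bilinear functional on `Lip_b(X) × Lip(X)` with finite mass,
continuity and locality. -/
structure IsCurrent (T : Functional1 X) : Prop where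
  finite_mass : ∃ μ : Measure X, MassBound T μ
  continuity : ∀ (f : LipBdd X) (π : LipFun X) (πs : ℕ → LipFun X) (K : ℝ≥0),
    (∀ j, LipschitzWith K (πs j : X → ℝ)) →
    (∀ x, Tendsto (fun j => (πs j : X → ℝ) x) atTop (𝓝 ((π : X → ℝ) x))) →
    Tendsto (fun j => T f (πs j)) atTop (𝓝 (T f π))
  locality : ∀ (f : LipBdd X) (π : LipFun X),
    (∃ U ∈ 𝓝ˢ (tsupport (f : X → ℝ)), ∃ a : ℝ, ∀ x ∈ U, (π : X → ℝ) x = a) → T f π = 0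

/-- The mass measure `‖T‖`: the smallest of the measures `μ` in the finite mass condition, written
as their infimum in the complete lattice of measures. -/
def massMeasure (T : Functional1 X) : Measure X := sInf {μ | MassBound T μ}

/-- The mass `M(T) = ‖T‖(X)`. -/
def mass (T : Functional1 X) : ℝ≥0∞ := massMeasure T univ

/-- The boundary `∂T(f) = T(1, f)`. -/
def boundary (T : Functional1 X) : Functional0 X := (T (oneBdd X)).comp LipBdd.toLipFun

/-- A functional on `D⁰(X)` has finite mass. -/
def FiniteMass0 (S : Functional0 X) : Prop :=
  ∃ μ : Measure X, IsFiniteMeasure μ ∧ ∀ f : LipBdd X, |S f| ≤ ∫ x, |(f : X → ℝ) x| ∂μ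

/-- A normal `1`-current: a metric `1`-current whose boundary has finite mass. -/
def IsNormal (T : Functional1 X) : Prop := IsCurrent T ∧ FiniteMass0 (boundary T)

/-- A cycle: a metric `1`-current with zero boundary. -/
def IsCycle (T : Functional1 X) : Prop := IsCurrent T ∧ boundary T = 0

end Currents

/-- The Kantorovich–Rubinstein norm of `∂T`: the supremum of `∂T(f) = T(1, f)` over all
`1`-Lipschitz functions `f`, which need not be bounded. As `f = 0` is among the competitors, the
supremum is nonnegative, and replacing negative values by `0` does not change it. -/
def krBoundary (T : Functional1 X) : ℝ≥0∞ :=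
  ⨆ (f : LipFun X) (_ : LipschitzWith 1 (f : X → ℝ)), ENNReal.ofReal (T (oneBdd X) f)

/-! ### Lipschitz curves -/

/-- A Lipschitz curve `θ : [0,1] → X`. -/
structure LipCurve (X : Type*) [MetricSpace X] where
  /-- the underlying map -/
  toFun : I → X
  lipschitz : ∃ K : ℝ≥0, LipschitzWith K toFun

/-- The curve extended to `ℝ`, constant on `(-∞, 0]` and on `[1, ∞)`. -/
def LipCurve.ext (θ : LipCurve X) : ℝ → X := IccExtend zero_le_one θ.toFun

theorem LipCurve.ext_lipschitz (θ : LipCurve X) : ∃ K : ℝ≥0, LipschitzWith K θ.ext := by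
  obtain ⟨K, hK⟩ := θ.lipschitz
  exact ⟨K * 1, hK.comp (LipschitzWith.projIcc zero_le_one)⟩

/-- The (upper) metric derivative `limsup_{h → 0+} d(θ(t+h), θ(t)) / h`. -/
def LipCurve.speed (θ : LipCurve X) (t : ℝ) : ℝ≥0∞ :=
  limsup (fun h : ℝ => edist (θ.ext (t + h)) (θ.ext t) / ENNReal.ofReal h) (𝓝[>] 0)

/-- The length `∫₀¹ |θ̇|(t) dt`. -/
def LipCurve.length (θ : LipCurve X) : ℝ≥0∞ := ∫⁻ t in Icc (0 : ℝ) 1, θ.speed t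

theorem LipCurve.intervalIntegrable (θ : LipCurve X) (f : LipBdd X) (π : LipFun X) :
    IntervalIntegrable
      (fun t => (f : X → ℝ) (θ.ext t) * deriv (fun s => (π : X → ℝ) (θ.ext s)) t)
      volume 0 1 := by
  obtain ⟨K, hK⟩ := θ.ext_lipschitz
  obtain ⟨⟨L, hL⟩, -⟩ := f.2
  obtain ⟨N, hN⟩ := π.2
  have hc : Continuous fun t => (f : X → ℝ) (θ.ext t) := (hL.comp hK).continuous
  have hd : IntervalIntegrable (deriv fun s => (π : X → ℝ) (θ.ext s)) volume 0 1 := by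
    refine (intervalIntegrable_const (c := ((N * K : ℝ≥0) : ℝ))).mono_fun
      (measurable_deriv _).aestronglyMeasurable (ae_of_all _ fun t => ?_)
    have h : LipschitzWith (N * K) fun s => (π : X → ℝ) (θ.ext s) := hN.comp hK
    simpa using norm_deriv_le_of_lipschitz h
  exact hd.continuousOn_mul hc.continuousOn

theorem LipCurve.ae_differentiableAt (θ : LipCurve X) (π : LipFun X) :
    ∀ᵐ t : ℝ, DifferentiableAt ℝ (fun s => (π : X → ℝ) (θ.ext s)) t := by
  obtain ⟨K, hK⟩ := θ.ext_lipschitz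
  obtain ⟨N, hN⟩ := π.2
  exact (hN.comp hK).ae_differentiableAt_real

/-- The curve current `⟦θ⟧(f, π) = ∫₀¹ f(θ(t)) (π ∘ θ)'(t) dt`. -/
def LipCurve.current (θ : LipCurve X) : Functional1 X :=
  LinearMap.mk₂ ℝ
    (fun f π => ∫ t in (0 : ℝ)..1,
      (f : X → ℝ) (θ.ext t) * deriv (fun s => (π : X → ℝ) (θ.ext s)) t)
    (fun f g π => by
      rw [← intervalIntegral.integral_add (θ.intervalIntegrable f π) (θ.intervalIntegrable g π)]
      exact intervalIntegral.integral_congr fun t _ => by simp [add_mul])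
    (fun a f π => by
      rw [smul_eq_mul, ← intervalIntegral.integral_const_mul]
      exact intervalIntegral.integral_congr fun t _ => by simp [mul_assoc])
    (fun f π ρ => by
      rw [← intervalIntegral.integral_add (θ.intervalIntegrable f π) (θ.intervalIntegrable f ρ)]
      refine intervalIntegral.integral_congr_ae ?_
      filter_upwards [θ.ae_differentiableAt π, θ.ae_differentiableAt ρ] with t h₁ h₂ _
      have h : deriv (fun s => ((π + ρ : LipFun X) : X → ℝ) (θ.ext s)) t =
          deriv (fun s => (π : X → ℝ) (θ.ext s)) t + deriv (fun s => (ρ : X → ℝ) (θ.ext s)) t :=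
        deriv_fun_add h₁ h₂
      rw [h, mul_add])
    (fun a f π => by
      rw [smul_eq_mul, ← intervalIntegral.integral_const_mul]
      refine intervalIntegral.integral_congr_ae ?_
      filter_upwards [θ.ae_differentiableAt π] with t h₁ _
      have h : deriv (fun s => ((a • π : LipFun X) : X → ℝ) (θ.ext s)) t =
          a * deriv (fun s => (π : X → ℝ) (θ.ext s)) t :=
        deriv_const_mul a h₁
      rw [h]
      ring)

/-- `P` is a finite real combination `∑ ηᵢ ⟦θᵢ⟧` of currents of curves from the class `𝒞`. -/
def IsCurveSum (𝒞 : Set (LipCurve X)) (P : Functional1 X) : Prop :=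
  ∃ (r : ℕ) (η : Fin r → ℝ) (θ : Fin r → LipCurve X),
    (∀ i, θ i ∈ 𝒞) ∧ P = ∑ i, η i • (θ i).current

/-- `Lip₁([0,1], X)`: the `1`-Lipschitz curves. -/
def lipOneCurves (X : Type*) [MetricSpace X] : Set (LipCurve X) := {θ | LipschitzWith 1 θ.toFun}

/-- The geodesics: Lipschitz curves whose length is the distance of the end points. -/
def geodesicCurves (X : Type*) [MetricSpace X] : Set (LipCurve X) :=
  {θ | θ.length = edist (θ.toFun 0) (θ.toFun 1)}

/-! ### Connectedness of spaces -/

/-- `X` is a geodesic space: any two points are joined by a geodesic. -/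
def IsGeodesicSpace (X : Type*) [MetricSpace X] : Prop :=
  ∀ x y : X, ∃ θ ∈ geodesicCurves X, θ.toFun 0 = x ∧ θ.toFun 1 = y

/-- `X` is piecewise quasiconvex with constant `c`. The chain has `n + 1 ≥ 1` curves
`θ₀, …, θₙ`, and its pairs of points are the end points `(θᵢ(0), θᵢ(1))` of these curves. -/
def IsPiecewiseQuasiconvex (X : Type*) [MetricSpace X] (c : ℝ≥0) : Prop :=
  1 ≤ c ∧ ∀ (x y : X) (ε : ℝ), 0 < ε → ∃ (n : ℕ) (θ : Fin (n + 1) → LipCurve X),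
    dist x ((θ 0).toFun 0) + dist ((θ (Fin.last n)).toFun 1) y
      + ∑ i : Fin n, dist ((θ i.succ).toFun 0) ((θ i.castSucc).toFun 1) < ε ∧
    ∑ i, (θ i).length ≤ c * edist x y

/-! ### Polyhedral currents -/

section Polyhedral

variable {E : Type*} [NormedAddCommGroup E] [NormedSpace ℝ E]

/-- The straight segment from `x` to `y`, `t ↦ (1 - t) x + t y`. -/
def segmentCurve (x y : E) : LipCurve E where
  toFun t := AffineMap.lineMap x y (t : ℝ)
  lipschitz := ⟨nndist x y * 1, (lipschitzWith_lineMap x y).comp (LipschitzWith.subtype_val _)⟩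

/-- Polyhedral `1`-currents: finite real combinations of oriented segments `⟦x, y⟧`. -/
def IsPolyhedral (P : Functional1 E) : Prop :=
  ∃ (r : ℕ) (η : Fin r → ℝ) (x y : Fin r → E), P = ∑ i, η i • (segmentCurve (x i) (y i)).current

end Polyhedral

end MetricCurrents

end

open MetricCurrents

universe u

noncomputable section

namespace MetricCurrents

variable {X : Type*} [MetricSpace X]

/-! ### Sums and multiples of currents -/


/-! The core is a one-step approximation (`exists_curveSum_boundary_approx`): if `T(1, f) ≤ R` for
all `1`-Lipschitz `f`, then for each `δ > 0` some finite sum of curves `Q` has mass at most `c (R +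
δ)` and leaves a remainder with `(T - Q)(1, f) ≤ δ` for all such `f`.

Only the functional `Λ = T(1, ·)` matters for this step. It kills constants and is continuous for
pointwise convergence with bounded Lipschitz constants. On a separable space the normalized
`1`-Lipschitz functions are compact for pointwise convergence, so separating the graph of `Λ` from
its vertical translate by `δ` yields a finitely supported functional uniformly `δ`-close to `Λ`
(`exists_finitely_supported_approx`). Finite Kantorovich duality writes it as a positive combination
of differences of point evaluations, with cost about `R` (`exists_transport_plan`). Replacing each
pair of points by a chain of curves costs a factor `c` in mass and an arbitrarily small error in the
boundary.

Applying the step to successive remainders, with summable tolerances, gives currents `Q k` whose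
masses sum to at most `c ‖∂T‖ + ε`, the norm being the Kantorovich–Rubinstein one. Their series
converges in mass to some `P`; the boundaries of the remainders tend to zero, so `C = T - P` is a
cycle. The curve class is a parameter: it need only supply chains, and its closure under subdivision
makes the curves `1`-Lipschitz. -/

theorem LipBdd.continuous (f : LipBdd X) : Continuous (f : X → ℝ) := by
  obtain ⟨⟨K, hK⟩, -⟩ := f.2
  exact hK.continuous

theorem LipBdd.exists_bound (f : LipBdd X) : ∃ B : ℝ, 0 ≤ B ∧ ∀ x, |(f : X → ℝ) x| ≤ B := by
  obtain ⟨-, B, hB⟩ := f.2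
  exact ⟨max B 0, le_max_right _ _, fun x => (hB x).trans (le_max_left _ _)⟩

section Algebra

variable [MeasurableSpace X]

theorem LipBdd.integrable_abs [BorelSpace X] (f : LipBdd X) (μ : Measure X) [IsFiniteMeasure μ] :
    Integrable (fun x => |(f : X → ℝ) x|) μ := by
  obtain ⟨B, -, hB⟩ := LipBdd.exists_bound f
  refine Integrable.of_bound (C := B) (LipBdd.continuous f).abs.measurable.aestronglyMeasurable
    (ae_of_all _ fun x => ?_)
  simpa using hB x

theorem LipBdd.integral_abs_le (f : LipBdd X) {B : ℝ} (hB : ∀ x, |(f : X → ℝ) x| ≤ B)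
    (μ : Measure X) [IsFiniteMeasure μ] : ∫ x, |(f : X → ℝ) x| ∂μ ≤ B * μ.real univ := by
  have h := norm_integral_le_of_norm_le_const (μ := μ) (f := fun x => |(f : X → ℝ) x|) (C := B)
    (ae_of_all _ fun x => by simpa using hB x)
  exact (le_abs_self _).trans h

theorem MassBound.zero : MassBound (0 : Functional1 X) 0 :=
  ⟨inferInstance, fun f π K _ => by simp⟩

theorem MassBound.add [BorelSpace X] {S T : Functional1 X} {μ ν : Measure X}
    (hS : MassBound S μ) (hT : MassBound T ν) : MassBound (S + T) (μ + ν) := by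
  have := hS.1
  have := hT.1
  refine ⟨inferInstance, fun f π K hK => ?_⟩
  rw [integral_add_measure (LipBdd.integrable_abs f μ) (LipBdd.integrable_abs f ν), mul_add]
  exact (abs_add_le _ _).trans (add_le_add (hS.2 f π K hK) (hT.2 f π K hK))

theorem MassBound.smul {T : Functional1 X} {μ : Measure X} (hT : MassBound T μ) (a : ℝ) :
    MassBound (a • T) (‖a‖₊ • μ) := by
  have := hT.1
  refine ⟨inferInstance, fun f π K hK => ?_⟩
  have h := mul_le_mul_of_nonneg_left (hT.2 f π K hK) (abs_nonneg a)
  rw [integral_smul_nnreal_measure]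
  simp only [LinearMap.smul_apply, smul_eq_mul, abs_mul, NNReal.smul_def, coe_nnnorm,
    Real.norm_eq_abs]
  linarith

/-- Since the mass comes from an infimum of bounding measures, one explicit bound suffices for every
mass estimate; the proof therefore carries measures along with currents. -/
theorem mass_le {T : Functional1 X} {μ : Measure X} (h : MassBound T μ) : mass T ≤ μ univ := by
  have h1 : massMeasure T ≤ μ := sInf_le h
  exact h1 univ

theorem IsCurrent.zero : IsCurrent (0 : Functional1 X) where
  finite_mass := ⟨0, MassBound.zero⟩
  continuity f π πs K _ _ := by simp
  locality f π _ := rfl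

theorem IsCurrent.add [BorelSpace X] {S T : Functional1 X} (hS : IsCurrent S) (hT : IsCurrent T) :
    IsCurrent (S + T) where
  finite_mass := by
    obtain ⟨μ, hμ⟩ := hS.finite_mass
    obtain ⟨ν, hν⟩ := hT.finite_mass
    exact ⟨μ + ν, hμ.add hν⟩
  continuity f π πs K h1 h2 := (hS.continuity f π πs K h1 h2).add (hT.continuity f π πs K h1 h2)
  locality f π h := by simp [hS.locality f π h, hT.locality f π h]

theorem IsCurrent.smul {T : Functional1 X} (hT : IsCurrent T) (a : ℝ) : IsCurrent (a • T) where
  finite_mass := by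
    obtain ⟨μ, hμ⟩ := hT.finite_mass
    exact ⟨_, hμ.smul a⟩
  continuity f π πs K h1 h2 := (hT.continuity f π πs K h1 h2).const_mul a
  locality f π h := by simp [hT.locality f π h]

theorem IsCurrent.sub [BorelSpace X] {S T : Functional1 X} (hS : IsCurrent S) (hT : IsCurrent T) :
    IsCurrent (S - T) := by
  have h := hS.add (hT.smul (-1))
  have e : S + (-1 : ℝ) • T = S - T := by module
  rwa [e] at h

theorem FiniteMass0.zero : FiniteMass0 (0 : Functional0 X) :=
  ⟨0, inferInstance, fun f => by simp⟩

theorem FiniteMass0.add [BorelSpace X] {S T : Functional0 X}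
    (hS : FiniteMass0 S) (hT : FiniteMass0 T) : FiniteMass0 (S + T) := by
  obtain ⟨μ, _, hμ⟩ := hS
  obtain ⟨ν, _, hν⟩ := hT
  refine ⟨μ + ν, inferInstance, fun f => ?_⟩
  rw [integral_add_measure (LipBdd.integrable_abs f μ) (LipBdd.integrable_abs f ν)]
  exact (abs_add_le _ _).trans (add_le_add (hμ f) (hν f))

theorem FiniteMass0.smul {T : Functional0 X} (hT : FiniteMass0 T) (a : ℝ) :
    FiniteMass0 (a • T) := by
  obtain ⟨μ, _, hμ⟩ := hT
  refine ⟨‖a‖₊ • μ, inferInstance, fun f => ?_⟩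
  rw [integral_smul_nnreal_measure]
  simpa [abs_mul, NNReal.smul_def] using mul_le_mul_of_nonneg_left (hμ f) (abs_nonneg a)

theorem IsNormal.zero : IsNormal (0 : Functional1 X) :=
  ⟨IsCurrent.zero, FiniteMass0.zero⟩

theorem IsNormal.add [BorelSpace X] {S T : Functional1 X} (hS : IsNormal S) (hT : IsNormal T) :
    IsNormal (S + T) :=
  ⟨hS.1.add hT.1, hS.2.add hT.2⟩

theorem IsNormal.smul {T : Functional1 X} (hT : IsNormal T) (a : ℝ) : IsNormal (a • T) :=
  ⟨hT.1.smul a, hT.2.smul a⟩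

/-- The sum of a series of currents that converges absolutely in mass. -/
theorem exists_series_current [BorelSpace X] {Q : ℕ → Functional1 X} {μ : ℕ → Measure X}
    (hQ : ∀ k, IsCurrent (Q k)) (hμ : ∀ k, MassBound (Q k) (μ k))
    (hfin : ∑' k, μ k univ ≠ ∞) :
    ∃ P : Functional1 X, IsCurrent P ∧
      (∀ f π, HasSum (fun k => Q k f π) (P f π)) ∧
      ∀ j, MassBound (P - ∑ k ∈ Finset.range j, Q k) (Measure.sum fun k => μ (k + j)) := by
  have hμf : ∀ k, IsFiniteMeasure (μ k) := fun k => (hμ k).1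
  have hreal : Summable fun k => (μ k).real univ := ENNReal.summable_toReal hfin
  have hsumint : ∀ (f : LipBdd X), Summable fun k => ∫ x, |(f : X → ℝ) x| ∂μ k := by
    intro f
    obtain ⟨B, hB0, hB⟩ := LipBdd.exists_bound f
    exact Summable.of_nonneg_of_le (fun k => integral_nonneg fun x => abs_nonneg _)
      (fun k => LipBdd.integral_abs_le f hB (μ k)) (hreal.mul_left B)
  have hsum : ∀ (f : LipBdd X) (π : LipFun X), Summable fun k => Q k f π := by
    intro f π
    obtain ⟨K, hK⟩ := π.2
    exact Summable.of_norm_bounded ((hsumint f).mul_left (K : ℝ)) fun k => (hμ k).2 f π K hK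
  let P : Functional1 X := LinearMap.mk₂ ℝ (fun f π => ∑' k, Q k f π)
    (fun f g π => by
      simp only [map_add, LinearMap.add_apply]
      exact (hsum f π).tsum_add (hsum g π))
    (fun a f π => by
      simp only [map_smul, LinearMap.smul_apply, smul_eq_mul]
      exact tsum_mul_left)
    (fun f π ρ => by
      simp only [map_add]
      exact (hsum f π).tsum_add (hsum f ρ))
    (fun a f π => by
      simp only [map_smul, smul_eq_mul]
      exact tsum_mul_left)
  have hP : ∀ f π, P f π = ∑' k, Q k f π := fun f π => rfl
  -- These tail bounds serve twice: `j = 0` gives finite mass of `P`, and general `j` gives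
  -- convergence in mass.
  have htail : ∀ j, MassBound (P - ∑ k ∈ Finset.range j, Q k)
      (Measure.sum fun k => μ (k + j)) := by
    intro j
    have hfm : IsFiniteMeasure (Measure.sum fun k => μ (k + j)) := by
      refine ⟨?_⟩
      rw [Measure.sum_apply _ MeasurableSet.univ]
      refine lt_of_le_of_lt ?_ hfin.lt_top
      exact ENNReal.tsum_comp_le_tsum_of_injective (add_left_injective j) fun k => μ k univ
    refine ⟨hfm, fun f π K hK => ?_⟩
    have h1 : (P - ∑ k ∈ Finset.range j, Q k) f π = ∑' k, Q (k + j) f π := by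
      have := (hsum f π).sum_add_tsum_nat_add j
      simp only [LinearMap.sub_apply, LinearMap.sum_apply, hP]
      linarith
    rw [h1, integral_sum_measure (LipBdd.integrable_abs f _)]
    have h2 : Summable fun k => ∫ x, |(f : X → ℝ) x| ∂μ (k + j) :=
      (summable_nat_add_iff j).2 (hsumint f)
    rw [← tsum_mul_left, ← Real.norm_eq_abs]
    exact tsum_of_norm_bounded (h2.mul_left (K : ℝ)).hasSum fun k => (hμ (k + j)).2 f π K hK
  refine ⟨P, ⟨⟨Measure.sum fun k => μ (k + 0), ?_⟩, ?_, ?_⟩, fun f π => (hsum f π).hasSum, htail⟩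
  · have e : P - ∑ k ∈ Finset.range 0, Q k = P := by
      rw [Finset.sum_range_zero]
      exact sub_zero P
    exact e ▸ htail 0
  -- The terms are dominated by `K ∫ |f| dμ k` uniformly along the sequence, so the limit passes
  -- through the series.
  · intro f π πs K hK hlim
    exact tendsto_tsum_of_dominated_convergence ((hsumint f).mul_left (K : ℝ))
      (fun k => (hQ k).continuity f π πs K hK hlim)
      (Eventually.of_forall fun n k => (hμ k).2 f (πs n) K (hK n))
  · intro f π h
    rw [hP]
    simp [(hQ _).locality f π h]

end Algebra

/-! ### Speed and length of Lipschitz curves -/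

namespace LipCurve

variable (θ : LipCurve X)

theorem ext_zero : θ.ext 0 = θ.toFun 0 := IccExtend_left _ _

theorem ext_one : θ.ext 1 = θ.toFun 1 := IccExtend_right _ _

theorem ext_coe (t : I) : θ.ext t = θ.toFun t := IccExtend_val _ _ t

theorem continuous_ext : Continuous θ.ext := by
  obtain ⟨K, hK⟩ := θ.ext_lipschitz
  exact hK.continuous

/-- The limsup is an infimum over countably many intervals `(0, 1/(n+1))`. The inner supremum is
uncountable, but of continuous functions of `t`, hence lower semicontinuous. -/
theorem measurable_speed : Measurable θ.speed := by
  have hb : (𝓝[>] (0 : ℝ)).HasBasis (fun _ : ℕ => True) fun n => Ioo 0 (1 / ((n : ℝ) + 1)) := by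
    refine (nhdsGT_basis (0 : ℝ)).to_hasBasis (fun ε hε => ?_) fun n _ => ?_
    · obtain ⟨n, hn⟩ := exists_nat_one_div_lt hε
      exact ⟨n, trivial, Ioo_subset_Ioo_right hn.le⟩
    · exact ⟨_, Nat.one_div_pos_of_nat, le_rfl⟩
  have h : θ.speed = fun t => ⨅ n : ℕ, ⨆ h ∈ Ioo (0 : ℝ) (1 / ((n : ℝ) + 1)),
      edist (θ.ext (t + h)) (θ.ext t) / ENNReal.ofReal h := by
    funext t
    rw [speed, hb.limsup_eq_iInf_iSup]
    simp
  rw [h]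
  refine Measurable.iInf fun n => LowerSemicontinuous.measurable ?_
  refine lowerSemicontinuous_iSup fun h => lowerSemicontinuous_iSup fun hh => ?_
  refine Continuous.lowerSemicontinuous ?_
  refine (ENNReal.continuous_div_const _ ?_).comp ?_
  · simpa using hh.1
  · exact (θ.continuous_ext.comp (continuous_add_const h)).edist θ.continuous_ext

theorem speed_le {K : ℝ≥0} (hK : LipschitzWith K θ.ext) (t : ℝ) : θ.speed t ≤ K := by
  refine limsup_le_of_le (by isBoundedDefault) ?_
  filter_upwards [self_mem_nhdsWithin] with h hh
  refine ENNReal.div_le_of_le_mul ?_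
  refine (hK _ _).trans (mul_le_mul_right ?_ _)
  rw [edist_dist, Real.dist_eq, add_sub_cancel_left, abs_of_pos hh]

theorem length_le {K : ℝ≥0} (hK : LipschitzWith K θ.ext) : θ.length ≤ K := by
  calc θ.length ≤ ∫⁻ _ in Icc (0 : ℝ) 1, (K : ℝ≥0∞) := lintegral_mono fun t => θ.speed_le hK t
    _ = K := by simp

theorem length_ne_top : θ.length ≠ ∞ := by
  obtain ⟨K, hK⟩ := θ.ext_lipschitz
  exact ((θ.length_le hK).trans_lt ENNReal.coe_lt_top).ne

theorem length_eq_Ioc : θ.length = ∫⁻ t in Ioc (0 : ℝ) 1, θ.speed t :=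
  (setLIntegral_congr Ioc_ae_eq_Icc).symm

/-- Right difference quotients of `π ∘ θ` are at most `K` times those of `θ`. Where `π ∘ θ` is not
differentiable, `deriv` has default value `0`. -/
theorem enorm_deriv_comp_le {π : X → ℝ} {K : ℝ≥0} (hπ : LipschitzWith K π) (t : ℝ) :
    ‖deriv (fun s => π (θ.ext s)) t‖ₑ ≤ K * θ.speed t := by
  by_cases hd : DifferentiableAt ℝ (fun s => π (θ.ext s)) t
  swap
  · simp [deriv_zero_of_not_differentiableAt hd]
  have h2 := (continuous_enorm.tendsto _).comp hd.hasDerivAt.tendsto_slope_zero_right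
  rw [← h2.limsup_eq, speed, ← ENNReal.limsup_const_mul_of_ne_top ENNReal.coe_ne_top]
  refine limsup_le_limsup ?_
  filter_upwards [self_mem_nhdsWithin] with h hh
  have hh : 0 < h := hh
  have h3 : ‖π (θ.ext (t + h)) - π (θ.ext t)‖ₑ ≤ K * edist (θ.ext (t + h)) (θ.ext t) := by
    rw [← edist_eq_enorm_sub]
    exact hπ _ _
  simp only [Function.comp_apply, smul_eq_mul, enorm_mul]
  rw [enorm_inv hh.ne', Real.enorm_eq_ofReal hh.le, mul_comm, ← div_eq_mul_inv, ← mul_div_assoc]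
  exact ENNReal.div_le_div_right h3 _

theorem exists_lipschitz_comp {π : X → ℝ} (hπ : ∃ K, LipschitzWith K π) :
    ∃ K : ℝ≥0, LipschitzWith K fun s => π (θ.ext s) := by
  obtain ⟨K, hK⟩ := hπ
  obtain ⟨L, hL⟩ := θ.ext_lipschitz
  exact ⟨_, hK.comp hL⟩

theorem absolutelyContinuous_comp {π : X → ℝ} (hπ : ∃ K, LipschitzWith K π) (a b : ℝ) :
    AbsolutelyContinuousOnInterval (fun s => π (θ.ext s)) a b := by
  obtain ⟨K, hK⟩ := θ.exists_lipschitz_comp hπ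
  exact hK.lipschitzOnWith.absolutelyContinuousOnInterval

/-- The distance from `θ(a)` is `1`-Lipschitz, so along the curve it is absolutely continuous with
derivative bounded by the speed. -/
theorem edist_le_lintegral_speed {a b : ℝ} (hab : a ≤ b) :
    edist (θ.ext a) (θ.ext b) ≤ ∫⁻ t in Ioc a b, θ.speed t := by
  have hπ : LipschitzWith 1 fun z => dist z (θ.ext a) := LipschitzWith.dist_left _
  have h1 := (θ.absolutelyContinuous_comp ⟨1, hπ⟩ a b).integral_deriv_eq_sub
  rw [dist_self, sub_zero, intervalIntegral.integral_of_le hab] at h1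
  calc edist (θ.ext a) (θ.ext b) = ‖dist (θ.ext b) (θ.ext a)‖ₑ := by
        rw [edist_comm, edist_dist, Real.enorm_eq_ofReal dist_nonneg]
    _ ≤ ∫⁻ t in Ioc a b, ‖deriv (fun s => dist (θ.ext s) (θ.ext a)) t‖ₑ := by
        rw [← h1]
        exact enorm_integral_le_lintegral_enorm _
    _ ≤ ∫⁻ t in Ioc a b, θ.speed t := lintegral_mono fun t => by
        simpa using θ.enorm_deriv_comp_le hπ t

theorem edist_le_length : edist (θ.toFun 0) (θ.toFun 1) ≤ θ.length := by
  rw [length_eq_Ioc, ← ext_zero, ← ext_one]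
  exact θ.edist_le_lintegral_speed zero_le_one

/-! ### Curve currents -/

theorem current_apply (f : LipBdd X) (π : LipFun X) :
    θ.current f π = ∫ t in (0 : ℝ)..1,
      (f : X → ℝ) (θ.ext t) * deriv (fun s => (π : X → ℝ) (θ.ext s)) t := rfl

theorem current_one (π : LipFun X) :
    θ.current (oneBdd X) π = (π : X → ℝ) (θ.toFun 1) - (π : X → ℝ) (θ.toFun 0) := by
  rw [current_apply, ← ext_zero, ← ext_one,
    ← (θ.absolutelyContinuous_comp π.2 0 1).integral_deriv_eq_sub]
  simp [oneBdd]

section Measurable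

variable [MeasurableSpace X] [BorelSpace X]

/-- The arc length measure of a curve, pushed forward to the space. -/
def arcMeasure : Measure X :=
  ((volume.restrict (Icc (0 : ℝ) 1)).withDensity θ.speed).map θ.ext

theorem arcMeasure_univ : θ.arcMeasure univ = θ.length := by
  rw [arcMeasure, Measure.map_apply θ.continuous_ext.measurable MeasurableSet.univ, preimage_univ,
    withDensity_apply _ MeasurableSet.univ, Measure.restrict_univ, length]

theorem massBound_current : MassBound θ.current θ.arcMeasure := by
  refine ⟨⟨?_⟩, fun f π K hK => ?_⟩
  · rw [arcMeasure_univ]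
    exact θ.length_ne_top.lt_top
  obtain ⟨L, hL⟩ := θ.ext_lipschitz
  have hlt : ∀ t, θ.speed t < ∞ := fun t => (θ.speed_le hL t).trans_lt ENNReal.coe_lt_top
  have hf := LipBdd.continuous f
  rw [arcMeasure, integral_map θ.continuous_ext.aemeasurable
    hf.abs.measurable.aestronglyMeasurable,
    integral_withDensity_eq_integral_toReal_smul θ.measurable_speed (ae_of_all _ hlt),
    ← integral_const_mul, current_apply, intervalIntegral.integral_of_le zero_le_one,
    ← integral_Icc_eq_integral_Ioc, ← Real.norm_eq_abs]
  have hg : Continuous fun t => |(f : X → ℝ) (θ.ext t)| := (hf.comp θ.continuous_ext).abs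
  refine norm_integral_le_of_norm_le ?_ (ae_of_all _ fun t => ?_)
  · refine Integrable.const_mul ?_ _
    refine Integrable.mono' (g := fun t => L * |(f : X → ℝ) (θ.ext t)|) ?_ ?_
      (ae_of_all _ fun t => ?_)
    · exact (continuous_const.mul hg).integrableOn_Icc
    · exact (θ.measurable_speed.ennreal_toReal.smul hg.measurable).aestronglyMeasurable
    · rw [norm_smul, Real.norm_eq_abs, Real.norm_eq_abs, abs_abs,
        abs_of_nonneg ENNReal.toReal_nonneg]
      refine mul_le_mul_of_nonneg_right ?_ (abs_nonneg _)
      exact ENNReal.toReal_le_coe_of_le_coe (θ.speed_le hL t)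
  · have h1 := ENNReal.toReal_mono (ENNReal.mul_ne_top ENNReal.coe_ne_top (hlt t).ne)
      (θ.enorm_deriv_comp_le hK t)
    rw [toReal_enorm, ENNReal.toReal_mul, ENNReal.coe_toReal] at h1
    rw [norm_mul, Real.norm_eq_abs, smul_eq_mul]
    calc _ ≤ |(f : X → ℝ) (θ.ext t)| * (K * (θ.speed t).toReal) :=
          mul_le_mul_of_nonneg_left h1 (abs_nonneg _)
      _ = _ := by ring

theorem isCurrent_current : IsCurrent θ.current where
  finite_mass := ⟨_, θ.massBound_current⟩
  continuity f π πs K hK hlim := by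
    -- Pointwise convergence of `πs j` says nothing about derivatives; integrating by parts moves
    -- the derivative onto the fixed `f`.
    have hparts : ∀ ρ : LipFun X, θ.current f ρ =
        (f : X → ℝ) (θ.ext 1) * (ρ : X → ℝ) (θ.ext 1)
          - (f : X → ℝ) (θ.ext 0) * (ρ : X → ℝ) (θ.ext 0)
          - ∫ t in (0 : ℝ)..1,
            deriv (fun s => (f : X → ℝ) (θ.ext s)) t * (ρ : X → ℝ) (θ.ext t) := fun ρ =>
      (θ.absolutelyContinuous_comp f.2.1 0 1).integral_mul_deriv_eq_deriv_mul
        (θ.absolutelyContinuous_comp ρ.2 0 1)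
    simp only [hparts]
    refine (((hlim _).const_mul _).sub ((hlim _).const_mul _)).sub ?_
    obtain ⟨L, hL⟩ := θ.ext_lipschitz
    obtain ⟨N, hN⟩ := θ.exists_lipschitz_comp f.2.1
    obtain ⟨B, hB⟩ := (hlim (θ.ext 0)).norm.bddAbove_range
    refine intervalIntegral.tendsto_integral_filter_of_dominated_convergence
      (fun _ => N * (B + K * L)) (Eventually.of_forall fun n => ?_)
      (Eventually.of_forall fun n => ae_of_all _ fun t ht => ?_) intervalIntegrable_const
      (ae_of_all _ fun t _ => (hlim _).const_mul _)
    · exact ((measurable_deriv _).mul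
        ((hK n).continuous.comp θ.continuous_ext).measurable).aestronglyMeasurable
    · rw [uIoc_of_le zero_le_one] at ht
      rw [norm_mul]
      refine mul_le_mul (norm_deriv_le_of_lipschitz hN) ?_ (norm_nonneg _) N.2
      have h1 := ((hK n).comp hL).dist_le_mul t 0
      have h2 : ‖(πs n : X → ℝ) (θ.ext 0)‖ ≤ B := hB ⟨n, rfl⟩
      have h3 : dist t 0 ≤ 1 := by
        rw [Real.dist_eq, sub_zero, abs_of_pos ht.1]
        exact ht.2
      have h4 : ((K * L : ℝ≥0) : ℝ) * dist t 0 ≤ K * L := by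
        simpa using mul_le_mul_of_nonneg_left h3 (K * L).2
      rw [dist_eq_norm] at h1
      have h5 := norm_sub_norm_le ((πs n : X → ℝ) (θ.ext t)) ((πs n : X → ℝ) (θ.ext 0))
      simp only [Function.comp_apply] at h1
      linarith
  locality f π := by
    rintro ⟨U, hU, a, ha⟩
    rw [current_apply]
    refine intervalIntegral.integral_zero_ae (ae_of_all _ fun t _ => ?_)
    -- On the support `π ∘ θ` is locally constant, and off it `f` vanishes.
    by_cases h : θ.ext t ∈ tsupport (f : X → ℝ)
    · have h1 : ∀ᶠ s in 𝓝 t, θ.ext s ∈ U :=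
        θ.continuous_ext.continuousAt (mem_nhdsSet_iff_forall.1 hU _ h)
      have h2 : (fun s => (π : X → ℝ) (θ.ext s)) =ᶠ[𝓝 t] fun _ => a :=
        h1.mono fun s hs => ha _ hs
      rw [h2.deriv_eq, deriv_const, mul_zero]
    · rw [image_eq_zero_of_notMem_tsupport h, zero_mul]

theorem isNormal_current : IsNormal θ.current := by
  refine ⟨θ.isCurrent_current, Measure.dirac (θ.toFun 1) + Measure.dirac (θ.toFun 0),
    inferInstance, fun f => ?_⟩
  rw [integral_add_measure (LipBdd.integrable_abs f _) (LipBdd.integrable_abs f _),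
    integral_dirac' _ _ (LipBdd.continuous f).abs.measurable.stronglyMeasurable,
    integral_dirac' _ _ (LipBdd.continuous f).abs.measurable.stronglyMeasurable]
  have h : boundary θ.current f = (f : X → ℝ) (θ.toFun 1) - (f : X → ℝ) (θ.toFun 0) :=
    θ.current_one (LipBdd.toLipFun f)
  rw [h]
  exact abs_sub _ _

end Measurable

/-! ### Subcurves -/

/-- The restriction of a curve to `[a, b]`, reparametrized on the unit interval. -/
def restrict (a b : ℝ) : LipCurve X where
  toFun t := θ.ext (a + (b - a) * t)
  lipschitz := by
    obtain ⟨K, hK⟩ := θ.ext_lipschitz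
    have h : LipschitzWith ‖b - a‖₊ fun t : I => a + (b - a) * (t : ℝ) := by
      refine LipschitzWith.of_dist_le_mul fun s t => le_of_eq ?_
      rw [Real.dist_eq, add_sub_add_left_eq_sub, ← mul_sub, abs_mul]
      rfl
    exact ⟨_, hK.comp h⟩

theorem lipschitzWith_restrict {K : ℝ≥0} (hK : LipschitzWith K θ.ext) (a b : ℝ) :
    LipschitzWith (K * ‖b - a‖₊) (θ.restrict a b).toFun := by
  refine hK.comp (f := θ.ext) (g := fun t : I => a + (b - a) * (t : ℝ)) ?_
  refine LipschitzWith.of_dist_le_mul fun s t => le_of_eq ?_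
  rw [Real.dist_eq, add_sub_add_left_eq_sub, ← mul_sub, abs_mul]
  rfl

theorem restrict_zero (a b : ℝ) : (θ.restrict a b).toFun 0 = θ.ext a := by
  simp [restrict]

theorem restrict_one (a b : ℝ) : (θ.restrict a b).toFun 1 = θ.ext b := by
  simp [restrict]

theorem restrict_ext {a b t : ℝ} (ht : t ∈ Icc (0 : ℝ) 1) :
    (θ.restrict a b).ext t = θ.ext (a + (b - a) * t) :=
  (θ.restrict a b).ext_coe ⟨t, ht⟩

/-- This is the chain rule for the substitution `h ↦ (b - a) h`. The point `t = 1` is excluded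
because the extended restriction stops there, while `θ` may go on. -/
theorem speed_restrict_le {a b : ℝ} (hab : a < b) {t : ℝ} (ht : t ∈ Ico (0 : ℝ) 1) :
    (θ.restrict a b).speed t ≤ ENNReal.ofReal (b - a) * θ.speed (a + (b - a) * t) := by
  have hpos : 0 < b - a := sub_pos.2 hab
  have htend : Tendsto (fun h : ℝ => (b - a) * h) (𝓝[>] 0) (𝓝[>] 0) := by
    refine tendsto_nhdsWithin_iff.2 ⟨?_, ?_⟩
    · have : Tendsto (fun h : ℝ => (b - a) * h) (𝓝 0) (𝓝 ((b - a) * 0)) :=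
        (continuous_const.mul continuous_id).tendsto 0
      rw [mul_zero] at this
      exact this.mono_left nhdsWithin_le_nhds
    · filter_upwards [self_mem_nhdsWithin] with h hh
      exact mul_pos hpos hh
  set F : ℝ → ℝ≥0∞ := fun h =>
    edist (θ.ext (a + (b - a) * t + h)) (θ.ext (a + (b - a) * t)) / ENNReal.ofReal h with hF
  have h1 : limsup (fun h => F ((b - a) * h)) (𝓝[>] 0) ≤ θ.speed (a + (b - a) * t) :=
    limsup_le_limsup_of_le (f := map (fun h : ℝ => (b - a) * h) (𝓝[>] 0)) htend
  refine le_trans ?_ (mul_le_mul_right h1 _)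
  rw [← ENNReal.limsup_const_mul_of_ne_top ENNReal.ofReal_ne_top]
  refine limsup_le_limsup ?_
  have hsmall : ∀ᶠ h : ℝ in 𝓝[>] 0, h < 1 - t :=
    nhdsWithin_le_nhds (Iio_mem_nhds (sub_pos.2 ht.2))
  filter_upwards [self_mem_nhdsWithin, hsmall] with h hh hh1
  have hh : 0 < h := hh
  have e : a + (b - a) * (t + h) = a + (b - a) * t + (b - a) * h := by ring
  have hne : ENNReal.ofReal (b - a) ≠ 0 := by simpa using hab
  rw [θ.restrict_ext ⟨ht.1, ht.2.le⟩, θ.restrict_ext ⟨by linarith [ht.1], by linarith⟩, e]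
  simp only [hF]
  rw [ENNReal.ofReal_mul hpos.le, ← mul_div_assoc,
    ENNReal.mul_div_mul_left _ _ hne ENNReal.ofReal_ne_top]

theorem length_restrict_le {a b : ℝ} (hab : a < b) :
    (θ.restrict a b).length ≤ ∫⁻ t in Ioc a b, θ.speed t := by
  have hpos : 0 < b - a := sub_pos.2 hab
  have himg : (fun t : ℝ => a + (b - a) * t) '' Ico 0 1 = Ico a b := by
    have := image_affine_Ico hpos a 0 1
    simp only [mul_zero, zero_add, mul_one, sub_add_cancel] at this
    rw [← this]
    exact image_congr fun t _ => add_comm _ _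
  calc (θ.restrict a b).length = ∫⁻ t in Ico (0 : ℝ) 1, (θ.restrict a b).speed t :=
        (setLIntegral_congr Ico_ae_eq_Icc).symm
    _ ≤ ∫⁻ t in Ico (0 : ℝ) 1, ENNReal.ofReal |b - a| * θ.speed (a + (b - a) * t) := by
        refine setLIntegral_mono_ae' measurableSet_Ico (ae_of_all _ fun t ht => ?_)
        rw [abs_of_pos hpos]
        exact θ.speed_restrict_le hab ht
    _ = ∫⁻ t in (fun t : ℝ => a + (b - a) * t) '' Ico 0 1, θ.speed t := by
        refine (lintegral_image_eq_lintegral_abs_deriv_mul measurableSet_Ico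
          (f' := fun _ => b - a) (fun x _ => ?_) (fun x _ y _ hxy => ?_) _).symm
        · simpa using (((hasDerivAt_id x).const_mul (b - a)).const_add a).hasDerivWithinAt
        · simpa [hpos.ne'] using hxy
    _ = ∫⁻ t in Ioc a b, θ.speed t := by
        rw [himg]
        exact setLIntegral_congr Ico_ae_eq_Ioc

theorem lintegral_speed_add {a b c : ℝ} (hab : a ≤ b) (hbc : b ≤ c) :
    (∫⁻ t in Ioc a b, θ.speed t) + ∫⁻ t in Ioc b c, θ.speed t = ∫⁻ t in Ioc a c, θ.speed t := by
  rw [← Ioc_union_Ioc_eq_Ioc hab hbc, lintegral_union measurableSet_Ioc]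
  exact Ioc_disjoint_Ioc_of_le le_rfl

/-- The lengths before, on and after `[a, b]` add up to the distance of the end points of `θ`. By
the triangle inequality this is at most the same sum with the middle length replaced by a distance;
cancelling the finite outer terms leaves length at most distance. -/
theorem restrict_mem_geodesicCurves (hθ : θ ∈ geodesicCurves X) {a b : ℝ} (ha : 0 ≤ a)
    (hab : a < b) (hb : b ≤ 1) : θ.restrict a b ∈ geodesicCurves X := by
  refine le_antisymm ?_ (edist_le_length _)
  rw [restrict_zero, restrict_one]
  refine (θ.length_restrict_le hab).trans ?_
  have h0 : (∫⁻ t in Ioc 0 a, θ.speed t) + (∫⁻ t in Ioc a b, θ.speed t)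
      + ∫⁻ t in Ioc b 1, θ.speed t = edist (θ.ext 0) (θ.ext 1) := by
    rw [θ.lintegral_speed_add ha hab.le, θ.lintegral_speed_add (ha.trans hab.le) hb, ext_zero,
      ext_one, ← hθ, length_eq_Ioc]
  have hne := edist_ne_top (θ.ext 0) (θ.ext 1)
  have h1 : edist (θ.ext 0) (θ.ext 1) ≤ (∫⁻ t in Ioc 0 a, θ.speed t)
      + edist (θ.ext a) (θ.ext b) + ∫⁻ t in Ioc b 1, θ.speed t :=
    (edist_triangle4 _ (θ.ext a) (θ.ext b) _).trans <| by
      gcongr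
      · exact θ.edist_le_lintegral_speed ha
      · exact θ.edist_le_lintegral_speed hb
  rw [← h0] at h1 hne
  have hne' := ENNReal.add_ne_top.1 hne
  exact (ENNReal.add_le_add_iff_left (ENNReal.add_ne_top.1 hne'.1).1).1
    ((ENNReal.add_le_add_iff_right hne'.2).1 h1)

theorem sum_length_restrict_le {N : ℕ} (hN : 0 < N) :
    ∑ i : Fin N, (θ.restrict (i / N) ((i + 1) / N)).length ≤ θ.length := by
  have hN' : (0 : ℝ) < N := by exact_mod_cast hN
  have h : ∀ n : ℕ, ∑ i ∈ Finset.range n, ∫⁻ t in Ioc ((i : ℝ) / N) ((i + 1) / N), θ.speed t =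
      ∫⁻ t in Ioc (0 : ℝ) (n / N), θ.speed t := by
    intro n
    induction n with
    | zero => simp
    | succ n ih =>
      rw [Finset.sum_range_succ, ih, Nat.cast_succ]
      exact θ.lintegral_speed_add (by positivity) (by gcongr; linarith)
  rw [Fin.sum_univ_eq_sum_range (fun i => (θ.restrict (i / N) ((i + 1) / N)).length), length_eq_Ioc]
  have h1 := h N
  rw [div_self hN'.ne'] at h1
  rw [← h1]
  exact Finset.sum_le_sum fun i _ => θ.length_restrict_le (by gcongr; linarith)

theorem sum_restrict_sub {N : ℕ} (hN : 0 < N) (f : X → ℝ) :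
    ∑ i : Fin N, (f ((θ.restrict (i / N) ((i + 1) / N)).toFun 1)
      - f ((θ.restrict (i / N) ((i + 1) / N)).toFun 0)) = f (θ.toFun 1) - f (θ.toFun 0) := by
  have hN' : (N : ℝ) ≠ 0 := by exact_mod_cast hN.ne'
  simp only [restrict_zero, restrict_one]
  rw [Fin.sum_univ_eq_sum_range fun i => f (θ.ext (((i : ℝ) + 1) / N)) - f (θ.ext ((i : ℝ) / N))]
  have h := Finset.sum_range_sub (fun i : ℕ => f (θ.ext ((i : ℝ) / N))) N
  simpa [hN', ext_zero, ext_one] using h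

/-- Fine enough uniform subdivisions of a Lipschitz curve consist of `1`-Lipschitz curves. -/
theorem exists_restrict_lipschitz : ∃ N : ℕ, 0 < N ∧ ∀ i : Fin N,
    θ.restrict (i / N) ((i + 1) / N) ∈ lipOneCurves X := by
  obtain ⟨K, hK⟩ := θ.ext_lipschitz
  obtain ⟨N, hN⟩ := exists_nat_gt K
  have hpos : 0 < N := by
    rcases Nat.eq_zero_or_pos N with h | h
    · simp [h] at hN
    · exact h
  refine ⟨N, hpos, fun i => (θ.lipschitzWith_restrict hK _ _).weaken ?_⟩
  have hN' : (0 : ℝ) < N := by exact_mod_cast hpos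
  rw [← NNReal.coe_le_coe]
  have e : ((i : ℝ) + 1) / N - i / N = 1 / N := by ring
  rw [e, NNReal.coe_mul, coe_nnnorm, Real.norm_of_nonneg (by positivity), mul_one_div]
  exact (div_le_one hN').2 (by exact_mod_cast hN.le)

end LipCurve

/-! ### Segments -/

section Segments

variable {E : Type*} [NormedAddCommGroup E] [NormedSpace ℝ E]

theorem segmentCurve_restrict (x y : E) {a b : ℝ} (ha : 0 ≤ a) (hab : a ≤ b) (hb : b ≤ 1) :
    (segmentCurve x y).restrict a b =
      segmentCurve (AffineMap.lineMap x y a) (AffineMap.lineMap x y b) := by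
  have h : ((segmentCurve x y).restrict a b).toFun =
      (segmentCurve (AffineMap.lineMap x y a) (AffineMap.lineMap x y b)).toFun := by
    funext t
    have ht0 := t.2.1
    have ht1 := t.2.2
    have hm : a + (b - a) * t ∈ Icc (0 : ℝ) 1 := by
      constructor
      · have := mul_nonneg (sub_nonneg.2 hab) ht0
        linarith
      · nlinarith
    change (segmentCurve x y).ext _ = AffineMap.lineMap _ _ (t : ℝ)
    rw [show (segmentCurve x y).ext (a + (b - a) * t) = AffineMap.lineMap x y (a + (b - a) * t) from
      (segmentCurve x y).ext_coe ⟨_, hm⟩]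
    simp only [AffineMap.lineMap_apply_module]
    module
  cases h1 : (segmentCurve x y).restrict a b
  cases h2 : segmentCurve (AffineMap.lineMap x y a) (AffineMap.lineMap x y b)
  simp_all

theorem length_segmentCurve_le (x y : E) : (segmentCurve x y).length ≤ edist x y := by
  have h1 : LipschitzWith (nndist x y) (segmentCurve x y).toFun := by
    have := (lipschitzWith_lineMap (𝕜 := ℝ) x y).comp (LipschitzWith.subtype_val (Icc (0 : ℝ) 1))
    rwa [mul_one] at this
  have h2 : LipschitzWith (nndist x y) (segmentCurve x y).ext := by
    have := h1.comp (LipschitzWith.projIcc (zero_le_one (α := ℝ)))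
    rwa [mul_one] at this
  exact ((segmentCurve x y).length_le h2).trans (edist_nndist x y).ge

end Segments

/-! ### Functionals on Lipschitz functions -/

/-- Sequential continuity with respect to pointwise convergence with bounded Lipschitz
constants. -/
def PointwiseContinuous (Λ : LipFun X →ₗ[ℝ] ℝ) : Prop :=
  ∀ (π : LipFun X) (πs : ℕ → LipFun X) (K : ℝ≥0),
    (∀ j, LipschitzWith K (πs j : X → ℝ)) →
    (∀ x, Tendsto (fun j => (πs j : X → ℝ) x) atTop (𝓝 ((π : X → ℝ) x))) →
    Tendsto (fun j => Λ (πs j)) atTop (𝓝 (Λ π))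

/-- A constant function as a Lipschitz function. -/
def constLip (X : Type*) [MetricSpace X] (a : ℝ) : LipFun X :=
  ⟨fun _ => a, 0, LipschitzWith.const a⟩

/-- Rescaling by a constant `L > K` and letting `L → K` also covers `K = 0`. -/
theorem abs_le_mul_of_le_on_lipschitz_one {Φ : LipFun X →ₗ[ℝ] ℝ} {R : ℝ}
    (h : ∀ f : LipFun X, LipschitzWith 1 (f : X → ℝ) → Φ f ≤ R) {f : LipFun X} {K : ℝ≥0}
    (hf : LipschitzWith K (f : X → ℝ)) : |Φ f| ≤ R * K := by
  have hpos : ∀ L : ℝ≥0, 0 < L → K ≤ L → |Φ f| ≤ R * L := by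
    intro L hL hKL
    have h1 : ∀ g : LipFun X, LipschitzWith K (g : X → ℝ) → Φ g ≤ R * L := by
      intro g hg
      have h2 : LipschitzWith 1 (((L : ℝ)⁻¹ • g : LipFun X) : X → ℝ) := by
        have h3 := (lipschitzWith_smul ((L : ℝ)⁻¹)).comp hg
        refine h3.weaken ?_
        rw [nnnorm_inv, NNReal.nnnorm_eq]
        exact (inv_mul_le_iff₀ hL).2 (by simpa using hKL)
      have h4 := h _ h2
      rw [map_smul, smul_eq_mul] at h4
      have hL' : (0 : ℝ) < L := hL
      rwa [inv_mul_le_iff₀ hL', mul_comm] at h4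
    refine abs_le'.2 ⟨h1 f hf, ?_⟩
    rw [← map_neg]
    exact h1 (-f) hf.neg
  have hlim : Tendsto (fun L : ℝ≥0 => R * (L : ℝ)) (𝓝[>] K) (𝓝 (R * K)) :=
    ((continuous_const.mul NNReal.continuous_coe).tendsto K).mono_left nhdsWithin_le_nhds
  refine ge_of_tendsto hlim ?_
  filter_upwards [self_mem_nhdsWithin] with L hL
  exact hpos L (lt_of_le_of_lt (zero_le (a := K)) hL) (le_of_lt hL)

/-! ### Finitely supported functionals: approximation and transport -/

theorem apply_eq_sum_of_vanishing {ι : Type*} [DecidableEq ι] (m : (ι → ℝ) →ₗ[ℝ] ℝ)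
    (F : Finset ι) (hF : ∀ f : ι → ℝ, (∀ i ∈ F, f i = 0) → m f = 0) (f : ι → ℝ) :
    m f = ∑ i ∈ F, f i * m (Pi.single i 1) := by
  have h := hF (f - ∑ i ∈ F, f i • Pi.single i 1) fun j hj => by
    simp [Finset.sum_apply, Pi.single_apply, hj]
  rw [map_sub, sub_eq_zero, map_sum] at h
  simpa using h

/-- A neighbourhood of zero in the product topology restricts only finitely many coordinates. If `v`
vanishes on these, all its multiples lie in `{|ψ| < 1}`, which forces `ψ v = 0`. -/
theorem exists_finite_support (ψ : (ℕ → ℝ) →L[ℝ] ℝ) :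
    ∃ J : Finset ℕ, ∀ v : ℕ → ℝ, (∀ n ∈ J, v n = 0) → ψ v = 0 := by
  have h1 : {v : ℕ → ℝ | |ψ v| < 1} ∈ 𝓝 (0 : ℕ → ℝ) := by
    refine (isOpen_lt ψ.continuous.abs continuous_const).mem_nhds ?_
    simp
  rw [nhds_pi, Filter.mem_pi] at h1
  obtain ⟨J, hJ, t, ht, hsub⟩ := h1
  refine ⟨hJ.toFinset, fun v hv => ?_⟩
  by_contra hne
  have h2 : (ψ v)⁻¹ • v ∈ J.pi t := fun n hn => by
    rw [Pi.smul_apply, hv n (hJ.mem_toFinset.2 hn), smul_zero]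
    exact mem_of_mem_nhds (ht n)
  have h3 : |ψ ((ψ v)⁻¹ • v)| < 1 := hsub h2
  rw [map_smul, smul_eq_mul, inv_mul_cancel₀ hne] at h3
  simp at h3

/-- Evaluation along a sequence of points, together with the value of a functional. -/
def graphMap (d : ℕ → X) (Λ : LipFun X →ₗ[ℝ] ℝ) : LipFun X →ₗ[ℝ] (ℕ → ℝ) × ℝ :=
  LinearMap.prod (LinearMap.pi fun n => (LinearMap.proj (d n)).comp (LipFun X).subtype) Λ

theorem graphMap_apply (d : ℕ → X) (Λ : LipFun X →ₗ[ℝ] ℝ) (f : LipFun X) :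
    graphMap d Λ f = (fun n => (f : X → ℝ) (d n), Λ f) := rfl

/-- The `1`-Lipschitz functions vanishing at a base point. -/
def lipBall (x₀ : X) : Set (LipFun X) := {f | LipschitzWith 1 (f : X → ℝ) ∧ (f : X → ℝ) x₀ = 0}

theorem convex_lipBall (x₀ : X) : Convex ℝ (lipBall x₀) := by
  rintro f ⟨hf, hf0⟩ g ⟨hg, hg0⟩ a b ha hb hab
  refine ⟨LipschitzWith.of_dist_le_mul fun x y => ?_, ?_⟩
  · have h1 := hf.dist_le_mul x y
    have h2 := hg.dist_le_mul x y
    rw [Real.dist_eq, NNReal.coe_one, one_mul] at *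
    have e : ((a • f + b • g : LipFun X) : X → ℝ) x - ((a • f + b • g : LipFun X) : X → ℝ) y =
        a * ((f : X → ℝ) x - (f : X → ℝ) y) + b * ((g : X → ℝ) x - (g : X → ℝ) y) := by
      simp only [Submodule.coe_add, Submodule.coe_smul, Pi.add_apply, Pi.smul_apply, smul_eq_mul]
      ring
    rw [e]
    calc _ ≤ |a * ((f : X → ℝ) x - (f : X → ℝ) y)| + |b * ((g : X → ℝ) x - (g : X → ℝ) y)| :=
          abs_add_le _ _
      _ ≤ a * dist x y + b * dist x y := by
          rw [abs_mul, abs_mul, abs_of_nonneg ha, abs_of_nonneg hb]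
          gcongr
      _ = dist x y := by rw [← add_mul, hab, one_mul]
  · simp [hf0, hg0]

/-- An Arzelà–Ascoli argument: extract a subsequence converging on the dense sequence, extend the
limit as a `1`-Lipschitz function, and use equicontinuity for convergence everywhere. Continuity of
`Λ` then handles the last coordinate. -/
theorem isCompact_graphMap_lipBall {d : ℕ → X} (hd : DenseRange d) {Λ : LipFun X →ₗ[ℝ] ℝ}
    (hΛ : PointwiseContinuous Λ) : IsCompact (graphMap d Λ '' lipBall (d 0)) := by
  refine IsSeqCompact.isCompact fun y hy => ?_
  choose f hf hfy using hy
  have hbox : IsCompact (Set.pi univ fun n => Icc (-dist (d n) (d 0)) (dist (d n) (d 0))) :=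
    isCompact_univ_pi fun n => isCompact_Icc
  have hmem : ∀ k, (fun n => (f k : X → ℝ) (d n)) ∈
      Set.pi univ fun n => Icc (-dist (d n) (d 0)) (dist (d n) (d 0)) := by
    intro k n _
    have h1 := (hf k).1.dist_le_mul (d n) (d 0)
    rw [(hf k).2, Real.dist_eq, sub_zero, NNReal.coe_one, one_mul] at h1
    exact abs_le.1 h1
  obtain ⟨g, -, φ, hφ, hg⟩ := hbox.tendsto_subseq hmem
  have hgn : ∀ n, Tendsto (fun k => (f (φ k) : X → ℝ) (d n)) atTop (𝓝 (g n)) :=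
    fun n => (tendsto_pi_nhds.1 hg) n
  -- Only the values on `range d` are used; elsewhere they may be junk, and `F` replaces them.
  set h : X → ℝ := fun x => limUnder atTop fun k => (f (φ k) : X → ℝ) x with hh
  have hhn : ∀ n, h (d n) = g n := fun n => (hgn n).limUnder_eq
  have hlip : LipschitzOnWith 1 h (range d) := by
    refine LipschitzOnWith.of_dist_le_mul ?_
    rintro _ ⟨n, rfl⟩ _ ⟨m, rfl⟩
    rw [hhn, hhn]
    exact le_of_tendsto' ((hgn n).dist (hgn m)) fun k => (hf (φ k)).1.dist_le_mul _ _
  obtain ⟨F, hF, hFh⟩ := hlip.extend_real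
  have hFn : ∀ n, F (d n) = g n := fun n => by rw [← hhn, hFh ⟨n, rfl⟩]
  have hlim : ∀ x, Tendsto (fun k => (f (φ k) : X → ℝ) x) atTop (𝓝 (F x)) := by
    intro x
    refine Metric.tendsto_atTop.2 fun ε hε => ?_
    obtain ⟨n, hn⟩ := hd.exists_dist_lt x (by positivity : 0 < ε / 3)
    obtain ⟨N, hN⟩ := Metric.tendsto_atTop.1 (hgn n) (ε / 3) (by positivity)
    refine ⟨N, fun k hk => ?_⟩
    have h1 := (hf (φ k)).1.dist_le_mul x (d n)
    have h2 := hF.dist_le_mul (d n) x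
    have h3 := hN k hk
    rw [NNReal.coe_one, one_mul] at h1 h2
    rw [dist_comm (d n) x] at h2
    rw [← hFn n] at h3
    have h4 := dist_triangle4 ((f (φ k) : X → ℝ) x) ((f (φ k) : X → ℝ) (d n)) (F (d n)) (F x)
    linarith
  have hF0 : F (d 0) = 0 := by
    refine tendsto_nhds_unique (hlim (d 0)) ?_
    simp only [(hf _).2]
    exact tendsto_const_nhds
  let G : LipFun X := ⟨F, 1, hF⟩
  refine ⟨graphMap d Λ G, ⟨G, ⟨hF, hF0⟩, rfl⟩, φ, hφ, ?_⟩
  have e : y ∘ φ = fun k => ((fun n => (f (φ k) : X → ℝ) (d n)), Λ (f (φ k))) := by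
    funext k
    rw [Function.comp_apply, ← hfy, graphMap_apply]
  rw [e, graphMap_apply]
  exact (tendsto_pi_nhds.2 fun n => hlim (d n)).prodMk_nhds
    (hΛ G (fun k => f (φ k)) 1 (fun k => (hf (φ k)).1) hlim)

/-- A pointwise continuous functional on the Lipschitz functions of a separable space that kills
constants is approximated, uniformly on `1`-Lipschitz functions, by finitely supported ones. -/
theorem exists_finitely_supported_approx [TopologicalSpace.SeparableSpace X] [Nonempty X]
    {Λ : LipFun X →ₗ[ℝ] ℝ} (hΛ : PointwiseContinuous Λ) (hconst : ∀ a, Λ (constLip X a) = 0)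
    {δ : ℝ} (hδ : 0 < δ) :
    ∃ (F : Finset X) (m : (X → ℝ) →ₗ[ℝ] ℝ), F.Nonempty ∧
      (∀ f : X → ℝ, (∀ x ∈ F, f x = 0) → m f = 0) ∧
      ∀ f : LipFun X, LipschitzWith 1 (f : X → ℝ) → Λ f - m (f : X → ℝ) ≤ δ := by
  classical
  set d : ℕ → X := TopologicalSpace.denseSeq X
  have hd : DenseRange d := TopologicalSpace.denseRange_denseSeq X
  set G := graphMap d Λ '' lipBall (d 0) with hG
  have hGc : IsCompact G := isCompact_graphMap_lipBall hd hΛ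
  have hGx : Convex ℝ G := (convex_lipBall (d 0)).linear_image _
  have hc1 : IsCompact ((fun p => ((0 : ℕ → ℝ), δ) + p) '' G) :=
    hGc.image (continuous_const_add _)
  -- Values on a dense sequence determine a continuous function, hence also its `Λ`-value, so no
  -- vertical shift by `δ > 0` can meet the graph.
  have hdisj : Disjoint G ((fun p => ((0 : ℕ → ℝ), δ) + p) '' G) := by
    rw [Set.disjoint_left]
    rintro _ ⟨f, hf, rfl⟩ ⟨_, ⟨g, hg, rfl⟩, hfg⟩
    simp only [graphMap_apply, Prod.mk_add_mk, zero_add, Prod.mk.injEq] at hfg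
    have h1 : (g : X → ℝ) = f := by
      refine hd.equalizer hg.1.continuous hf.1.continuous ?_
      exact hfg.1
    have h2 : g = f := Subtype.ext h1
    rw [h2] at hfg
    linarith [hfg.2]
  obtain ⟨φ, u, v, hu, huv, hv⟩ := geometric_hahn_banach_compact_closed hGx hGc
    (hGx.translate _) hc1.isClosed hdisj
  set s := φ (0, 1) with hs
  set ψ : (ℕ → ℝ) →L[ℝ] ℝ := φ.comp (ContinuousLinearMap.inl ℝ (ℕ → ℝ) ℝ)
  have hφ : ∀ w t, φ (w, t) = ψ w + t * s := by
    intro w t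
    have e : ((w, t) : (ℕ → ℝ) × ℝ) = (w, 0) + t • (0, 1) := by simp
    rw [e, map_add, map_smul, smul_eq_mul]
    rfl
  have h0 : (0 : LipFun X) ∈ lipBall (d 0) := ⟨LipschitzWith.const' 0 |>.weaken zero_le_one, rfl⟩
  -- Testing the separation on the zero function gives `0 < u < v < δ s`: the separating hyperplane
  -- is not vertical.
  have hu0 := hu _ ⟨0, h0, rfl⟩
  rw [map_zero, map_zero] at hu0
  have hv0 := hv _ ⟨_, ⟨0, h0, rfl⟩, rfl⟩
  simp only [map_zero, add_zero] at hv0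
  rw [hφ, map_zero, zero_add] at hv0
  have hspos : 0 < s := pos_of_mul_pos_right (hu0.trans (huv.trans hv0)) hδ.le
  obtain ⟨J, hJ⟩ := exists_finite_support ψ
  let B : (X → ℝ) →ₗ[ℝ] (ℕ → ℝ) :=
    LinearMap.pi fun n => (LinearMap.proj (d n) : (X → ℝ) →ₗ[ℝ] ℝ) - LinearMap.proj (d 0)
  have hB : ∀ f n, B f n = f (d n) - f (d 0) := fun f n => rfl
  -- Solving `ψ(w) + t s < δ s` for `t` dictates the witness `-s⁻¹ ψ`. Precomposing with `B`
  -- subtracts the value at the base point, which makes the estimate valid for unnormalized `f`.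
  refine ⟨insert (d 0) (J.image d), (-s⁻¹) • (ψ : (ℕ → ℝ) →ₗ[ℝ] ℝ).comp B,
    Finset.insert_nonempty _ _, fun f hf => ?_, fun f hf => ?_⟩
  · have h1 : ψ (B f) = 0 := hJ _ fun n hn => by
      rw [hB, hf _ (Finset.mem_insert_self _ _),
        hf _ (Finset.mem_insert_of_mem (Finset.mem_image_of_mem d hn)), sub_zero]
    simp [h1]
  · set g : LipFun X := f - constLip X ((f : X → ℝ) (d 0)) with hg
    have hgx : ∀ x, (g : X → ℝ) x = (f : X → ℝ) x - (f : X → ℝ) (d 0) := fun x => rfl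
    have hgball : g ∈ lipBall (d 0) := by
      refine ⟨LipschitzWith.of_dist_le_mul fun x y => ?_, ?_⟩
      · rw [hgx, hgx, dist_sub_right]
        exact hf.dist_le_mul x y
      · rw [hgx, sub_self]
    have hΛg : Λ g = Λ f := by rw [hg, map_sub, hconst, sub_zero]
    have h1 := hu _ ⟨g, hgball, rfl⟩
    rw [graphMap_apply, hφ, hΛg] at h1
    have h2 : (fun n => (g : X → ℝ) (d n)) = B f := by
      funext n
      rw [hgx, hB]
    rw [h2] at h1
    have h3 : ψ (B f) + Λ f * s < δ * s := h1.trans (huv.trans hv0)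
    have h4 : s⁻¹ * ψ (B f) + Λ f < δ := by
      have := mul_lt_mul_of_pos_left h3 (inv_pos.2 hspos)
      field_simp at this ⊢
      linarith
    simp only [LinearMap.smul_apply, LinearMap.comp_apply, smul_eq_mul,
      ContinuousLinearMap.coe_coe]
    linarith

/-- Kantorovich duality for finitely supported functionals. -/
theorem exists_transport_plan {F : Finset X} (hne : F.Nonempty) {m : (X → ℝ) →ₗ[ℝ] ℝ}
    (hF : ∀ f : X → ℝ, (∀ x ∈ F, f x = 0) → m f = 0) {r : ℝ} (hr : 0 < r)
    (hm : ∀ (f : X → ℝ) (K : ℝ≥0), LipschitzWith K f → m f ≤ r * K) :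
    ∃ (N : ℕ) (a : Fin N → ℝ) (x y : Fin N → X), (∀ i, 0 ≤ a i) ∧
      ∑ i, a i * dist (x i) (y i) ≤ r ∧ ∀ f, m f = ∑ i, a i * (f (y i) - f (x i)) := by
  classical
  have hm_eq := apply_eq_sum_of_vanishing m F hF
  set b : X → ℝ := fun x => m (Pi.single x 1)
  -- Elementary transports scaled to cost `r`; on the diagonal they are zero.
  let w : F × F → F → ℝ := fun p =>
    (r * (dist (p.1 : X) p.2)⁻¹) • (Pi.single p.2 1 - Pi.single p.1 1)
  -- Otherwise a separating functional is given by a potential `γ` on `F` that is `u / r`-Lipschitz.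
  -- Its Lipschitz extension `H` satisfies `m H ≤ u`, whereas separation says `m H > u`.
  have key : (fun x : F => b x) ∈ convexHull ℝ (range w) := by
    by_contra hnot
    obtain ⟨g, u, hu, hug⟩ := geometric_hahn_banach_closed_point (convex_convexHull ℝ _)
      ((finite_range w).isClosed_convexHull ℝ) hnot
    have hgw : ∀ p, g (w p) < u := fun p => hu _ (subset_convexHull ℝ _ ⟨p, rfl⟩)
    have hu0 : 0 < u := by
      obtain ⟨x, hx⟩ := hne
      have := hgw (⟨x, hx⟩, ⟨x, hx⟩)
      simpa [w] using this
    set γ : F → ℝ := fun x => g (Pi.single x 1)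
    have hgγ : ∀ v : F → ℝ, g v = ∑ x, v x * γ x := by
      intro v
      conv_lhs => rw [← Finset.univ_sum_single v]
      rw [map_sum]
      refine Finset.sum_congr rfl fun x _ => ?_
      have : (Pi.single x (v x) : F → ℝ) = v x • Pi.single x 1 := by
        rw [← Pi.single_smul, smul_eq_mul, mul_one]
      rw [this, map_smul, smul_eq_mul]
    set G : X → ℝ := fun x => if h : x ∈ F then γ ⟨x, h⟩ else 0
    have hGF : ∀ x : F, G x = γ x := fun x => by simp [G]
    have hle : ∀ x y : F, γ y - γ x ≤ (u / r) * dist (x : X) y := by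
      intro x y
      by_cases hxy : x = y
      · simp [hxy]
      have hpos : 0 < dist (x : X) y := dist_pos.2 fun h => hxy (Subtype.ext h)
      have h1 := hgw (x, y)
      simp only [w, map_smul, map_sub, smul_eq_mul] at h1
      change r * (dist (x : X) y)⁻¹ * (γ y - γ x) < u at h1
      rw [div_mul_eq_mul_div, le_div_iff₀ hr]
      rw [← div_eq_mul_inv, div_mul_eq_mul_div, div_lt_iff₀ hpos] at h1
      linarith
    have hur : 0 ≤ u / r := (div_pos hu0 hr).le
    have hLip : LipschitzOnWith ⟨u / r, hur⟩ G F := by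
      refine LipschitzOnWith.of_dist_le_mul fun x hx y hy => ?_
      have hx' := hGF ⟨x, hx⟩
      have hy' := hGF ⟨y, hy⟩
      have h1 := hle ⟨x, hx⟩ ⟨y, hy⟩
      have h2 := hle ⟨y, hy⟩ ⟨x, hx⟩
      rw [← hx', ← hy'] at h1 h2
      rw [Real.dist_eq]
      refine abs_le.2 ⟨?_, ?_⟩
      · change -(u / r * dist x y) ≤ _
        linarith
      · change _ ≤ u / r * dist x y
        rw [dist_comm y x] at h2
        exact h2
    obtain ⟨H, hH, hHG⟩ := hLip.extend_real
    have h1 := hm H _ hH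
    have h2 : m H = g fun x : F => b x := by
      rw [hm_eq, hgγ, ← Finset.sum_coe_sort F]
      refine Finset.sum_congr rfl fun x _ => ?_
      rw [← hHG x.2, hGF, mul_comm]
    rw [h2] at h1
    change _ ≤ r * (u / r) at h1
    rw [mul_div_cancel₀ _ hr.ne'] at h1
    linarith
  obtain ⟨ι, _, c, z, hc0, hc1, hz, hsum⟩ := mem_convexHull_iff_exists_fintype.1 key
  choose p hp using hz
  let e := Fintype.equivFin ι
  refine ⟨Fintype.card ι,
    fun i => c (e.symm i) * (r * (dist ((p (e.symm i)).1 : X) (p (e.symm i)).2)⁻¹),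
    fun i => (p (e.symm i)).1, fun i => (p (e.symm i)).2, fun i => ?_, ?_, fun f => ?_⟩
  · have := hc0 (e.symm i)
    positivity
  · rw [e.symm.sum_comp fun i => c i * (r * (dist ((p i).1 : X) (p i).2)⁻¹)
      * dist ((p i).1 : X) (p i).2]
    calc _ ≤ ∑ i, c i * r := Finset.sum_le_sum fun i _ => by
          rw [mul_assoc, mul_assoc]
          refine mul_le_mul_of_nonneg_left ?_ (hc0 i)
          exact mul_le_of_le_one_right hr.le inv_mul_le_one
      _ = r := by rw [← Finset.sum_mul, hc1, one_mul]
  · rw [e.symm.sum_comp fun i => c i * (r * (dist ((p i).1 : X) (p i).2)⁻¹)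
      * (f (p i).2 - f (p i).1), hm_eq, ← Finset.sum_coe_sort F]
    have h1 : ∀ x : F, b x = ∑ i, c i * w (p i) x := fun x => by
      have := congrFun hsum x
      simp only [Finset.sum_apply, Pi.smul_apply, smul_eq_mul, ← hp] at this
      exact this.symm
    have h2 : ∀ q : F × F, ∑ x : F, f x * w q x =
        r * (dist (q.1 : X) q.2)⁻¹ * (f q.2 - f q.1) := by
      intro q
      simp only [w, Pi.smul_apply, Pi.sub_apply, smul_eq_mul, Pi.single_apply]
      simp only [mul_sub, Finset.sum_sub_distrib]
      simp
      ring
    calc ∑ x : F, f x * b x = ∑ x : F, ∑ i, c i * (f x * w (p i) x) := by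
          refine Finset.sum_congr rfl fun x _ => ?_
          rw [h1, Finset.mul_sum]
          exact Finset.sum_congr rfl fun i _ => by ring
      _ = ∑ i, c i * ∑ x : F, f x * w (p i) x := by
          rw [Finset.sum_comm]
          exact Finset.sum_congr rfl fun i _ => (Finset.mul_sum _ _ _).symm
      _ = _ := Finset.sum_congr rfl fun i _ => by rw [h2, mul_assoc, mul_assoc, mul_assoc]

/-! ### Sums of curve currents -/

theorem IsCurveSum.of_fintype {𝒞 : Set (LipCurve X)} {ι : Type*} [Fintype ι] (η : ι → ℝ)
    {θ : ι → LipCurve X} (hθ : ∀ i, θ i ∈ 𝒞) : IsCurveSum 𝒞 (∑ i, η i • (θ i).current) := by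
  let e := Fintype.equivFin ι
  refine ⟨Fintype.card ι, fun i => η (e.symm i), fun i => θ (e.symm i), fun i => hθ _, ?_⟩
  exact (e.symm.sum_comp fun i => η i • (θ i).current).symm

theorem IsCurveSum.zero (𝒞 : Set (LipCurve X)) : IsCurveSum 𝒞 0 :=
  ⟨0, Fin.elim0, Fin.elim0, fun i => i.elim0, by simp⟩

theorem IsCurveSum.add {𝒞 : Set (LipCurve X)} {P Q : Functional1 X} (hP : IsCurveSum 𝒞 P)
    (hQ : IsCurveSum 𝒞 Q) : IsCurveSum 𝒞 (P + Q) := by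
  obtain ⟨r, η, θ, hθ, rfl⟩ := hP
  obtain ⟨s, ζ, ξ, hξ, rfl⟩ := hQ
  have h := IsCurveSum.of_fintype (𝒞 := 𝒞) (Sum.elim η ζ) (θ := Sum.elim θ ξ)
    (by rintro (i | i) <;> simp [hθ, hξ])
  simpa using h

theorem IsCurveSum.mono {𝒞 𝒟 : Set (LipCurve X)} (h : 𝒞 ⊆ 𝒟) {P : Functional1 X}
    (hP : IsCurveSum 𝒞 P) : IsCurveSum 𝒟 P := by
  obtain ⟨r, η, θ, hθ, rfl⟩ := hP
  exact ⟨r, η, θ, fun i => h (hθ i), rfl⟩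

section Sums

variable [MeasurableSpace X] [BorelSpace X]

theorem MassBound.sum {ι : Type*} (s : Finset ι) {T : ι → Functional1 X} {μ : ι → Measure X}
    (h : ∀ i, MassBound (T i) (μ i)) : MassBound (∑ i ∈ s, T i) (∑ i ∈ s, μ i) := by
  classical
  induction s using Finset.induction_on with
  | empty => simpa using MassBound.zero
  | insert i s hi ih =>
    rw [Finset.sum_insert hi, Finset.sum_insert hi]
    exact (h i).add ih

theorem IsNormal.sum {ι : Type*} (s : Finset ι) {T : ι → Functional1 X}
    (h : ∀ i, IsNormal (T i)) : IsNormal (∑ i ∈ s, T i) :=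
  Finset.sum_induction _ _ (fun _ _ => IsNormal.add) IsNormal.zero fun i _ => h i

end Sums

/-! ### Chains of curves -/

/-- Any two points are joined, up to a small error in the sense of currents, by finitely many
curves of the class `𝒞` of total length at most `c` times the distance. -/
def HasChains (𝒞 : Set (LipCurve X)) (c : ℝ≥0) : Prop :=
  ∀ (x y : X) (ε : ℝ), 0 < ε → ∃ (n : ℕ) (θ : Fin n → LipCurve X), (∀ i, θ i ∈ 𝒞) ∧
    ∑ i, (θ i).length ≤ c * edist x y ∧
    ∀ (f : X → ℝ) (K : ℝ≥0), LipschitzWith K f →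
      f y - f x - ∑ i, (f ((θ i).toFun 1) - f ((θ i).toFun 0)) ≤ ε * K

theorem HasChains.of_curves {𝒞 : Set (LipCurve X)} {c : ℝ≥0}
    (h : ∀ x y : X, ∃ θ ∈ 𝒞, θ.toFun 0 = x ∧ θ.toFun 1 = y ∧ θ.length ≤ c * edist x y) :
    HasChains 𝒞 c := by
  intro x y ε hε
  obtain ⟨θ, hθ, rfl, rfl, hl⟩ := h x y
  refine ⟨1, fun _ => θ, fun _ => hθ, by simpa using hl, fun f K _ => ?_⟩
  have : 0 ≤ ε * K := by positivity
  simpa using this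

/-- Cutting a curve does not increase total length, and the end point differences telescope. -/
theorem HasChains.subdivide {𝒞 : Set (LipCurve X)} {c : ℝ≥0} (h : HasChains 𝒞 c)
    (hres : ∀ θ ∈ 𝒞, ∀ a b : ℝ, 0 ≤ a → a < b → b ≤ 1 → θ.restrict a b ∈ 𝒞) :
    HasChains (lipOneCurves X ∩ 𝒞) c := by
  intro x y ε hε
  obtain ⟨n, θ, hθ, hl, hf⟩ := h x y ε hε
  choose N hN hlip using fun i => (θ i).exists_restrict_lipschitz
  let ξ : (Σ i : Fin n, Fin (N i)) → LipCurve X := fun p =>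
    (θ p.1).restrict (p.2 / N p.1) ((p.2 + 1) / N p.1)
  let e := Fintype.equivFin (Σ i : Fin n, Fin (N i))
  refine ⟨_, fun k => ξ (e.symm k), fun k => ⟨hlip _ _, hres _ (hθ _) _ _ ?_ ?_ ?_⟩, ?_,
    fun f K hK => ?_⟩
  · positivity
  · have : (0 : ℝ) < N (e.symm k).1 := by exact_mod_cast hN _
    gcongr
    linarith
  · have : (0 : ℝ) < N (e.symm k).1 := by exact_mod_cast hN _
    rw [div_le_one this]
    exact_mod_cast (e.symm k).2.2
  · rw [e.symm.sum_comp fun p => (ξ p).length, Fintype.sum_sigma]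
    exact (Finset.sum_le_sum fun i _ => (θ i).sum_length_restrict_le (hN i)).trans hl
  · rw [e.symm.sum_comp fun p => f ((ξ p).toFun 1) - f ((ξ p).toFun 0), Fintype.sum_sigma]
    have : ∀ i, ∑ j : Fin (N i), (f ((ξ ⟨i, j⟩).toFun 1) - f ((ξ ⟨i, j⟩).toFun 0)) =
        f ((θ i).toFun 1) - f ((θ i).toFun 0) := fun i => (θ i).sum_restrict_sub (hN i) f
    simp only [this]
    exact hf f K hK

/-- After regrouping, the error is a sum of differences of `f` across the gaps of the chain, whose
total size is less than `ε`. -/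
theorem IsPiecewiseQuasiconvex.hasChains {c : ℝ≥0} (h : IsPiecewiseQuasiconvex X c) :
    HasChains (univ : Set (LipCurve X)) c := by
  intro x y ε hε
  obtain ⟨n, θ, hd, hl⟩ := h.2 x y ε hε
  refine ⟨n + 1, θ, fun _ => mem_univ _, hl, fun f K hK => ?_⟩
  have e : f y - f x - ∑ i, (f ((θ i).toFun 1) - f ((θ i).toFun 0)) =
      (f y - f ((θ (Fin.last n)).toFun 1)) + (f ((θ 0).toFun 0) - f x)
        + ∑ i : Fin n, (f ((θ i.succ).toFun 0) - f ((θ i.castSucc).toFun 1)) := by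
    rw [Finset.sum_sub_distrib, Finset.sum_sub_distrib, Fin.sum_univ_castSucc,
      Fin.sum_univ_succ (fun i => f ((θ i).toFun 0))]
    ring
  have hle : ∀ a b, f a - f b ≤ K * dist a b := fun a b =>
    (le_abs_self _).trans (hK.dist_le_mul a b)
  rw [e]
  calc _ ≤ K * dist y ((θ (Fin.last n)).toFun 1) + K * dist ((θ 0).toFun 0) x
        + ∑ i : Fin n, K * dist ((θ i.succ).toFun 0) ((θ i.castSucc).toFun 1) :=
        add_le_add (add_le_add (hle _ _) (hle _ _)) (Finset.sum_le_sum fun i _ => hle _ _)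
    _ = K * (dist x ((θ 0).toFun 0) + dist ((θ (Fin.last n)).toFun 1) y
        + ∑ i : Fin n, dist ((θ i.succ).toFun 0) ((θ i.castSucc).toFun 1)) := by
        rw [← Finset.mul_sum, dist_comm y, dist_comm _ x]
        ring
    _ ≤ K * ε := mul_le_mul_of_nonneg_left hd.le K.2
    _ = ε * K := mul_comm _ _

theorem hasChains_geodesicCurves (hX : IsGeodesicSpace X) {c : ℝ≥0} (hc : 1 ≤ c) :
    HasChains (geodesicCurves X) c := by
  refine HasChains.of_curves fun x y => ?_
  obtain ⟨θ, hθ, rfl, rfl⟩ := hX x y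
  refine ⟨θ, hθ, rfl, rfl, (le_of_eq hθ).trans ?_⟩
  exact le_mul_of_one_le_left zero_le (by exact_mod_cast hc)

theorem hasChains_segmentCurve {E : Type*} [NormedAddCommGroup E] [NormedSpace ℝ E] {c : ℝ≥0}
    (hc : 1 ≤ c) : HasChains {θ : LipCurve E | ∃ x y, θ = segmentCurve x y} c := by
  refine HasChains.of_curves fun x y => ⟨segmentCurve x y, ⟨x, y, rfl⟩, ?_, ?_, ?_⟩
  · simp [segmentCurve]
  · simp [segmentCurve]
  · exact (length_segmentCurve_le x y).trans
      (le_mul_of_one_le_left zero_le (by exact_mod_cast hc))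

/-! ### Approximation by curve currents -/

section Approximation

variable [MeasurableSpace X]

theorem IsCurrent.apply_constLip {T : Functional1 X} (hT : IsCurrent T) (f : LipBdd X) (a : ℝ) :
    T f (constLip X a) = 0 :=
  hT.locality _ _ ⟨univ, univ_mem, a, fun _ _ => rfl⟩

theorem krBoundary_ne_top {T : Functional1 X} (hT : IsCurrent T) : krBoundary T ≠ ∞ := by
  obtain ⟨μ, hμ, h⟩ := hT.finite_mass
  refine ne_top_of_le_ne_top (b := ENNReal.ofReal (∫ x, |(oneBdd X : X → ℝ) x| ∂μ))
    ENNReal.ofReal_ne_top (iSup₂_le fun f hf => ENNReal.ofReal_le_ofReal ?_)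
  have := h (oneBdd X) f 1 hf
  rw [NNReal.coe_one, one_mul] at this
  exact (le_abs_self _).trans this

theorem apply_le_krBoundary {T : Functional1 X} (hT : IsCurrent T) {f : LipFun X}
    (hf : LipschitzWith 1 (f : X → ℝ)) : T (oneBdd X) f ≤ (krBoundary T).toReal := by
  refine (ENNReal.ofReal_le_iff_le_toReal (krBoundary_ne_top hT)).1 ?_
  exact le_iSup₂ (f := fun (f : LipFun X) (_ : LipschitzWith 1 (f : X → ℝ)) =>
    ENNReal.ofReal (T (oneBdd X) f)) f hf

variable [BorelSpace X]

/-- The boundary of a current is approximated in the Kantorovich–Rubinstein norm by boundaries of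
sums of curves of controlled total length. -/
theorem exists_curveSum_boundary_approx [TopologicalSpace.SeparableSpace X] [Nonempty X]
    {𝒞 : Set (LipCurve X)} {c : ℝ≥0} (h𝒞 : HasChains 𝒞 c) {T : Functional1 X} (hT : IsCurrent T)
    {R : ℝ} (hR0 : 0 ≤ R)
    (hR : ∀ f : LipFun X, LipschitzWith 1 (f : X → ℝ) → T (oneBdd X) f ≤ R)
    {δ : ℝ} (hδ : 0 < δ) :
    ∃ (Q : Functional1 X) (μ : Measure X), IsCurveSum 𝒞 Q ∧ IsNormal Q ∧ MassBound Q μ ∧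
      μ univ ≤ c * ENNReal.ofReal (R + δ) ∧
      ∀ f : LipFun X, LipschitzWith 1 (f : X → ℝ) → (T - Q) (oneBdd X) f ≤ δ := by
  -- Half of `δ` pays for this approximation, the other half for the gaps in the chains.
  obtain ⟨F, m, hne, hF, happ⟩ := exists_finitely_supported_approx (Λ := T (oneBdd X))
    (fun π πs K => hT.continuity _ π πs K) (hT.apply_constLip _) (half_pos hδ)
  have hm1 : ∀ f : LipFun X, LipschitzWith 1 (f : X → ℝ) →
      (m.comp (LipFun X).subtype) f ≤ R + δ := by
    intro f hf
    have h1 := happ (-f) hf.neg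
    have h2 := hR f hf
    rw [map_neg, Submodule.coe_neg, map_neg] at h1
    change m (f : X → ℝ) ≤ _
    linarith
  obtain ⟨N, a, x, y, ha, hsum, hm⟩ := exists_transport_plan hne hF (add_pos_of_nonneg_of_pos hR0 hδ)
    fun f K hf => (le_abs_self _).trans
      (abs_le_mul_of_le_on_lipschitz_one hm1 (f := ⟨f, K, hf⟩) hf)
  set A := ∑ i, a i
  have hA : 0 ≤ A := Finset.sum_nonneg fun i _ => ha i
  -- The weights `a i` sum to `A`, so this tolerance keeps the weighted errors below `δ / 2`; the `+
  -- 1` avoids dividing by zero.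
  choose n θ hθ hlen hbd using fun i => h𝒞 (x i) (y i) (δ / 2 / (A + 1)) (by positivity)
  let η : (Σ i : Fin N, Fin (n i)) → ℝ := fun p => a p.1
  let ξ : (Σ i : Fin N, Fin (n i)) → LipCurve X := fun p => θ p.1 p.2
  refine ⟨∑ p, η p • (ξ p).current, ∑ p, ‖η p‖₊ • (ξ p).arcMeasure,
    IsCurveSum.of_fintype η fun p => hθ _ _,
    IsNormal.sum _ fun p => (ξ p).isNormal_current.smul _,
    MassBound.sum _ fun p => (ξ p).massBound_current.smul _, ?_, fun f hf => ?_⟩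
  · rw [Measure.finsetSum_apply, Fintype.sum_sigma]
    calc _ = ∑ i, ENNReal.ofReal (a i) * ∑ j, (θ i j).length := by
          refine Finset.sum_congr rfl fun i _ => ?_
          rw [Finset.mul_sum]
          refine Finset.sum_congr rfl fun j _ => ?_
          rw [Measure.smul_apply, LipCurve.arcMeasure_univ, ← Real.enorm_eq_ofReal (ha i)]
          rfl
      _ ≤ ∑ i, ENNReal.ofReal (a i) * (c * edist (x i) (y i)) :=
          Finset.sum_le_sum fun i _ => mul_le_mul_right (hlen i) _
      _ = c * ENNReal.ofReal (∑ i, a i * dist (x i) (y i)) := by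
          rw [ENNReal.ofReal_sum_of_nonneg fun i _ => mul_nonneg (ha i) dist_nonneg,
            Finset.mul_sum]
          refine Finset.sum_congr rfl fun i _ => ?_
          rw [ENNReal.ofReal_mul (ha i), edist_dist]
          ring
      _ ≤ _ := mul_le_mul_right (ENNReal.ofReal_le_ofReal hsum) _
  · have h1 : (∑ p, η p • (ξ p).current) (oneBdd X) f = ∑ i, a i *
        ∑ j, ((f : X → ℝ) ((θ i j).toFun 1) - (f : X → ℝ) ((θ i j).toFun 0)) := by
      simp only [LinearMap.sum_apply, LinearMap.smul_apply, LipCurve.current_one, smul_eq_mul]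
      rw [Fintype.sum_sigma]
      exact Finset.sum_congr rfl fun i _ => (Finset.mul_sum Finset.univ _ (a i)).symm
    have h2 := happ f hf
    rw [hm] at h2
    have h3 : ∑ i, a i * ((f : X → ℝ) (y i) - (f : X → ℝ) (x i)) - ∑ i, a i *
        ∑ j, ((f : X → ℝ) ((θ i j).toFun 1) - (f : X → ℝ) ((θ i j).toFun 0))
          ≤ A * (δ / 2 / (A + 1)) := by
      rw [← Finset.sum_sub_distrib, Finset.sum_mul]
      refine Finset.sum_le_sum fun i _ => ?_
      rw [← mul_sub]
      refine mul_le_mul_of_nonneg_left ?_ (ha i)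
      simpa using hbd i f 1 hf
    have h4 : A * (δ / 2 / (A + 1)) ≤ δ / 2 := by
      rw [mul_div_assoc', div_le_iff₀ (by positivity)]
      nlinarith
    rw [LinearMap.sub_apply, LinearMap.sub_apply, h1]
    linarith

theorem exists_cycle_add_curveSums_of_nonempty [TopologicalSpace.SeparableSpace X] [Nonempty X]
    {𝒞 : Set (LipCurve X)} {c : ℝ≥0} (h𝒞 : HasChains 𝒞 c) {T : Functional1 X} (hT : IsCurrent T)
    {ε : ℝ≥0} (hε : 0 < ε) :
    ∃ (C : Functional1 X) (P : ℕ → Functional1 X), IsCycle C ∧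
      (∀ j, IsNormal (P j)) ∧ (∀ j, IsCurveSum 𝒞 (P j)) ∧
      Tendsto (fun j => mass (T - C - P j)) atTop (𝓝 0) ∧
      ∀ j, mass (P j) ≤ c * krBoundary T + ε := by
  -- Each `δ k` enters the mass twice, as slack in step `k` and as the boundary bound for step `k +
  -- 1`; both are multiplied by `c`.
  have hε' : (ε / (2 * (c + 1)) : ℝ≥0) ≠ 0 := by positivity
  obtain ⟨δ, hδpos, hδsum⟩ := ENNReal.exists_pos_sum_of_countable
    (ENNReal.coe_ne_zero.2 hε') ℕ
  let ρ : ℕ → ℝ := fun k => Nat.casesOn k (krBoundary T).toReal fun k => δ k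
  have hρ0 : ∀ k, 0 ≤ ρ k := fun k => by
    cases k with
    | zero => exact ENNReal.toReal_nonneg
    | succ k => exact (δ k).2
  -- A remainder must carry its boundary bound `ρ k`, since the choice of the next `Q` depends on
  -- it.
  let State (k : ℕ) := {S : Functional1 X // IsCurrent S ∧
    ∀ f : LipFun X, LipschitzWith 1 (f : X → ℝ) → S (oneBdd X) f ≤ ρ k}
  choose Q μ hQsum hQnormal hQmass hμ hQδ using fun (k : ℕ) (S : State k) =>
    exists_curveSum_boundary_approx h𝒞 S.2.1 (hρ0 k) S.2.2 (δ := δ k) (hδpos k)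
  let S : ∀ k, State k := fun k => Nat.rec ⟨T, hT, fun f hf => apply_le_krBoundary hT hf⟩
    (fun k S => ⟨S.1 - Q k S, S.2.1.sub (hQnormal k S).1, hQδ k S⟩) k
  have hS : ∀ k, (S k).1 = T - ∑ i ∈ Finset.range k, Q i (S i) := by
    intro k
    induction k with
    | zero =>
      rw [Finset.sum_range_zero]
      exact (sub_zero T).symm
    | succ k ih =>
      have h1 : (S (k + 1)).1 = (S k).1 - Q k (S k) := rfl
      rw [h1, ih, Finset.sum_range_succ]
      exact sub_sub T _ _
  have hμsum : ∑' k, μ k (S k) univ ≤ c * krBoundary T + ε := by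
    calc ∑' k, μ k (S k) univ ≤ ∑' k, c * (ENNReal.ofReal (ρ k) + δ k) := by
          refine ENNReal.tsum_le_tsum fun k => (hμ k (S k)).trans ?_
          rw [ENNReal.ofReal_add (hρ0 k) (NNReal.coe_nonneg _), ENNReal.ofReal_coe_nnreal]
      _ = c * (ENNReal.ofReal (krBoundary T).toReal + ∑' k, (δ k : ℝ≥0∞)
            + ∑' k, (δ k : ℝ≥0∞)) := by
          rw [ENNReal.tsum_mul_left, ENNReal.tsum_add,
            tsum_eq_zero_add' (f := fun k => ENNReal.ofReal (ρ k)) ENNReal.summable]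
          simp [ρ]
      _ ≤ c * (krBoundary T + (ε / (2 * (c + 1)) : ℝ≥0) + (ε / (2 * (c + 1)) : ℝ≥0)) := by
          gcongr
          exact ENNReal.ofReal_toReal_le
      _ = c * krBoundary T + (c * (ε / (2 * (c + 1)) + ε / (2 * (c + 1))) : ℝ≥0) := by
          push_cast
          ring
      _ ≤ c * krBoundary T + ε := by
          gcongr
          have e : ε / (2 * (c + 1)) + ε / (2 * (c + 1)) = ε / (c + 1) := by
            field_simp
            norm_num
          rw [e, mul_div_assoc', div_le_iff₀ (by positivity), mul_comm]
          gcongr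
          exact le_self_add
  have hfin : ∑' k, μ k (S k) univ ≠ ∞ :=
    ne_top_of_le_ne_top (ENNReal.add_ne_top.2 ⟨ENNReal.mul_ne_top ENNReal.coe_ne_top
      (krBoundary_ne_top hT), ENNReal.coe_ne_top⟩) hμsum
  obtain ⟨P, hP, hPsum, htail⟩ := exists_series_current
    (fun k => (hQnormal k (S k)).1) (fun k => hQmass k (S k)) hfin
  refine ⟨T - P, fun j => ∑ k ∈ Finset.range j, Q k (S k), ⟨hT.sub hP, ?_⟩,
    fun j => IsNormal.sum _ fun k => hQnormal k (S k),
    fun j => Finset.sum_induction _ _ (fun _ _ => IsCurveSum.add) (IsCurveSum.zero 𝒞)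
      fun k _ => hQsum k (S k), ?_, fun j => ?_⟩
  · ext f
    obtain ⟨K, hK⟩ := f.2.1
    set g := LipBdd.toLipFun f
    change (T - P) (oneBdd X) g = 0
    -- The remainders `S k` converge to `T - P`, while their boundary values at `g` are at most `ρ k
    -- * K`, which tends to zero.
    have h1 : Tendsto (fun k => (S k).1 (oneBdd X) g) atTop (𝓝 ((T - P) (oneBdd X) g)) := by
      have h2 := (hPsum (oneBdd X) g).tendsto_sum_nat.const_sub (T (oneBdd X) g)
      simpa only [hS, LinearMap.sub_apply, LinearMap.sum_apply] using h2
    have h3 : Tendsto ρ atTop (𝓝 0) := by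
      refine (tendsto_add_atTop_iff_nat 1).1 ?_
      have h4 : Summable δ := ENNReal.tsum_coe_ne_top_iff_summable.1 (hδsum.trans_le le_top).ne
      exact (NNReal.summable_coe.2 h4).tendsto_atTop_zero
    have h5 : Tendsto (fun k => (S k).1 (oneBdd X) g) atTop (𝓝 0) := by
      refine squeeze_zero_norm (fun k => ?_) (by simpa using h3.mul_const (K : ℝ))
      exact abs_le_mul_of_le_on_lipschitz_one (S k).2.2 (f := g) hK
    exact tendsto_nhds_unique h1 h5
  · refine tendsto_of_tendsto_of_tendsto_of_le_of_le tendsto_const_nhds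
      (ENNReal.tendsto_sum_nat_add (fun k => μ k (S k) univ) hfin) (fun j => zero_le)
      fun j => ?_
    have e : T - (T - P) - ∑ k ∈ Finset.range j, Q k (S k) =
        P - ∑ k ∈ Finset.range j, Q k (S k) :=
      congrArg (fun V => V - ∑ k ∈ Finset.range j, Q k (S k)) (sub_sub_cancel T P)
    simp only [e]
    refine (mass_le (htail j)).trans (le_of_eq ?_)
    rw [Measure.sum_apply _ MeasurableSet.univ]
  · refine (mass_le (MassBound.sum _ fun k => hQmass k (S k))).trans (le_trans ?_ hμsum)
    rw [Measure.finsetSum_apply]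
    exact ENNReal.sum_le_tsum _

/-- Every metric `1`-current is the sum of a cycle and a mass limit of sums of curves whose mass is
controlled by the Kantorovich–Rubinstein norm of the boundary. -/
theorem exists_cycle_add_curveSums [TopologicalSpace.SeparableSpace X]
    {𝒞 : Set (LipCurve X)} {c : ℝ≥0} (h𝒞 : HasChains 𝒞 c) {T : Functional1 X} (hT : IsCurrent T)
    {ε : ℝ≥0} (hε : 0 < ε) :
    ∃ (C : Functional1 X) (P : ℕ → Functional1 X), IsCycle C ∧
      (∀ j, IsNormal (P j)) ∧ (∀ j, IsCurveSum 𝒞 (P j)) ∧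
      Tendsto (fun j => mass (T - C - P j)) atTop (𝓝 0) ∧
      ∀ j, mass (P j) ≤ c * krBoundary T + ε := by
  cases isEmpty_or_nonempty X with
  | inr h => exact exists_cycle_add_curveSums_of_nonempty h𝒞 hT hε
  | inl h =>
    have hzero : mass (0 : Functional1 X) = 0 := le_antisymm (mass_le MassBound.zero) zero_le
    have hT0 : T = 0 := by
      ext f
      -- On the empty space all functions coincide, so every functional is zero.
      rw [Subsingleton.elim f 0, map_zero, map_zero]
    refine ⟨0, fun _ => 0, ⟨IsCurrent.zero, rfl⟩, fun _ => IsNormal.zero,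
      fun _ => IsCurveSum.zero 𝒞, ?_, fun j => ?_⟩
    · have e : T - 0 - 0 = 0 := by
        rw [hT0]
        ext f
        simp
      simp only [e, hzero]
      exact tendsto_const_nhds
    · rw [hzero]
      exact zero_le

end Approximation

theorem IsCurveSum.isPolyhedral {E : Type*} [NormedAddCommGroup E] [NormedSpace ℝ E]
    {P : Functional1 E} (hP : IsCurveSum {θ : LipCurve E | ∃ x y, θ = segmentCurve x y} P) :
    IsPolyhedral P := by
  obtain ⟨r, η, θ, hθ, rfl⟩ := hP
  choose x y hxy using hθ
  exact ⟨r, η, x, y, by simp only [hxy]⟩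

end MetricCurrents

end

/-! ### The three choices of curve class: all curves, geodesics, segments -/

theorem theoremB :
    -- the approximation in piecewise quasiconvex spaces
    (∀ (X : Type u) [MetricSpace X] [TopologicalSpace.SeparableSpace X] [MeasurableSpace X]
        [BorelSpace X] (c : ℝ≥0), IsPiecewiseQuasiconvex X c →
      ∀ T : Functional1 X, IsCurrent T → ∀ ε : ℝ≥0, 0 < ε →
      ∃ (C : Functional1 X) (P : ℕ → Functional1 X), IsCycle C ∧
        (∀ j, IsNormal (P j)) ∧
        (∀ j, IsCurveSum (lipOneCurves X) (P j)) ∧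
        Tendsto (fun j => mass (T - C - P j)) atTop (𝓝 0) ∧
        ∀ j, mass (P j) ≤ c * krBoundary T + ε) ∧
    -- in geodesic spaces, the curves can be chosen to be geodesics
    (∀ (X : Type u) [MetricSpace X] [TopologicalSpace.SeparableSpace X] [MeasurableSpace X]
        [BorelSpace X] (c : ℝ≥0), IsPiecewiseQuasiconvex X c → IsGeodesicSpace X →
      ∀ T : Functional1 X, IsCurrent T → ∀ ε : ℝ≥0, 0 < ε →
      ∃ (C : Functional1 X) (P : ℕ → Functional1 X), IsCycle C ∧
        (∀ j, IsNormal (P j)) ∧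
        (∀ j, IsCurveSum (lipOneCurves X ∩ geodesicCurves X) (P j)) ∧
        Tendsto (fun j => mass (T - C - P j)) atTop (𝓝 0) ∧
        ∀ j, mass (P j) ≤ c * krBoundary T + ε) ∧
    -- in Banach spaces, the currents can be chosen to be polyhedral
    (∀ (X : Type u) [NormedAddCommGroup X] [NormedSpace ℝ X] [CompleteSpace X]
        [TopologicalSpace.SeparableSpace X] [MeasurableSpace X] [BorelSpace X] (c : ℝ≥0),
        IsPiecewiseQuasiconvex X c →
      ∀ T : Functional1 X, IsCurrent T → ∀ ε : ℝ≥0, 0 < ε →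
      ∃ (C : Functional1 X) (P : ℕ → Functional1 X), IsCycle C ∧
        (∀ j, IsNormal (P j)) ∧
        (∀ j, IsCurveSum (lipOneCurves X) (P j)) ∧
        (∀ j, IsPolyhedral (P j)) ∧
        Tendsto (fun j => mass (T - C - P j)) atTop (𝓝 0) ∧
        ∀ j, mass (P j) ≤ c * krBoundary T + ε) := by
  refine ⟨?_, ?_, ?_⟩
  · intro X _ _ _ _ c hX T hT ε hε
    have h := hX.hasChains.subdivide fun _ _ _ _ _ _ _ => mem_univ _
    rw [inter_univ] at h
    exact exists_cycle_add_curveSums h hT hε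
  · intro X _ _ _ _ c hX hgeo T hT ε hε
    exact exists_cycle_add_curveSums ((hasChains_geodesicCurves hgeo hX.1).subdivide
      fun θ hθ _ _ => θ.restrict_mem_geodesicCurves hθ) hT hε
  · intro X _ _ _ _ _ _ c hX T hT ε hε
    have h : HasChains (lipOneCurves X ∩ {θ | ∃ x y, θ = segmentCurve x y}) c :=
      (hasChains_segmentCurve hX.1).subdivide fun θ hθ a b ha hab hb => by
        obtain ⟨x, y, rfl⟩ := hθ
        exact ⟨_, _, segmentCurve_restrict x y ha hab.le hb⟩
    obtain ⟨C, P, hC, hN, hP, hlim, hmass⟩ := exists_cycle_add_curveSums h hT hε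
    exact ⟨C, P, hC, hN, fun j => (hP j).mono inter_subset_left,
      fun j => ((hP j).mono inter_subset_right).isPolyhedral, hlim, hmass⟩
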